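/- Let $d,p\ge 1$ and let $\mathbf X$ be a (simple, locally finite) point process on $\mathbb R^d$; write $N(B)$ for the number of its points in $B$, and $|\cdot|$ for Lebesgue measure. Let $\mathbf z:\mathbb R^d\to\mathbb R^p$ (covariates) and $w:\mathbb R^d\to\mathbb R$ (weights) be measurable, put $\rho(u;\beta)=\exp(\beta^\top\mathbf z(u))$, let $p_\lambda:[0,\infty)\to[0,\infty)$, $\lambda\ge 0$, be penalty functions with $p_\lambda(0)=0$, and let $\lambda_{n,j}\ge 0$ ($n\ge1$, $1\le j\le p$) be tuning parameters. Let $\beta_0=(\beta_{01},\dots,\beta_{0p})^\top$ be the true parameter, whose first $s$ coordinates are nonzero and whose other coordinates are zero. Let $\rho^{(k)}$ denote the $k$-th order product density of $\mathbf X$ (the Lebesgue density of its $k$-th order factorial moment measure), let $g(u,v)=\rho^{(2)}(u,v)/\{\rho(u;\beta_0)\rho(v;\beta_0)\}$, and let $$\alpha_{k,l}(q)=\sup\{|P(A\cap B)-P(A)P(B)|: A\in\mathscr F(\Lambda_1),\,B\in\mathscr F(\Lambda_2),\ |\Lambda_1|\le k,\ |\Lambda_2|\le l,\ d(\Lambda_1,\Lambda_2)\ge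 q\},$$ where $\Lambda_1,\Lambda_2$ are Borel sets, $\mathscr F(\Lambda)$ is the $\sigma$-algebra generated by $\mathbf X\cap\Lambda$, and $d(\Lambda_1,\Lambda_2)$ is the minimal distance. Assume: (C.1) $D_n=nE$, where $E\subset\mathbb R^d$ is convex, compact and contains the origin in its interior. (C.2) $\mathbf X$ has intensity function $\rho(\cdot;\beta_0)$, with $\beta_0\in\Theta$, where $\Theta\subset\mathbb R^p$ is open, convex and bounded. (C.3) $\sup_u\|\mathbf z(u)\|<\infty$ and $\sup_u|w(u)|<\infty$. (C.4) There is an integer $t\ge1$ such that for $k=2,\dots,2+t$ the product density $\rho^{(k)}$ exists and is bounded. (C.5) There is $\tilde t>d(2+t)/t$ with $\alpha_{2,\infty}(q)=O(q^{-\tilde t})$ as $q\to\infty$. (C.6) There is a positive definite matrix $\mathbf I_0$ such that $|D_n|^{-1}(\mathbf B_n+\mathbf C_n)\ge\mathbf I_0$ for all large $n$, where $\mathbf B_n=\int_{D_n}w(u)^2\mathbf z(u)\mathbf z(u)^\top\rho(u;\beta_0)\,du$ and $\mathbf C_n=\int_{D_n}\int_{D_n}w(u)w(v)\mathbf z(u)\mathbf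 z(v)^\top\{g(u,v)-1\}\rho(u;\beta_0)\rho(v;\beta_0)\,dv\,du$. (C.7) There is a positive definite matrix $\mathbf I_0'$ such that $|D_n|^{-1}\mathbf A_n\ge\mathbf I_0'$ for all large $n$, where $\mathbf A_n=\int_{D_n}w(u)\mathbf z(u)\mathbf z(u)^\top\rho(u;\beta_0)\,du$. (C.8) Each $p_\lambda$ is continuously differentiable on $(0,\infty)$ with Lipschitz derivative. Moreover there are $\tilde r_{n,j}$ ($1\le j\le s$) with $|D_n|^{1/2}\tilde r_{n,j}\to\infty$ such that for all large $n$ each $p_{\lambda_{n,j}}$, $1\le j\le s$, is three times continuously differentiable on the part in $(0,\infty)$ of the ball centred at $|\beta_{0j}|$ with radius $\tilde r_{n,j}$, with third derivative bounded there by a constant not depending on $n$ and $j$. Put $a_n=\max_{1\le j\le s}|p'_{\lambda_{n,j}}(|\beta_{0j}|)|$ and $c_n=\max_{1\le j\le s}|p''_{\lambda_{n,j}}(|\beta_{0j}|)|$ (both $0$ if $s=0$), and $$Q_n(w;\beta)=\sum_{u\in\mathbf X\cap D_n}w(u)\log\rho(u;\beta)-\int_{D_n}w(u)\rho(u;\beta)\,du-|D_n|\sum_{j=1}^p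 p_{\lambda_{n,j}}(|\beta_j|).$$ **Theorem.** If $a_n=O(|D_n|^{-1/2})$ and $c_n=o(1)$ as $n\to\infty$, then there are random vectors $\hat\beta=\hat\beta_n$ such that, with probability tending to one, $\hat\beta_n\in\Theta$ is a local maximizer of $\beta\mapsto Q_n(w;\beta)$, and $\|\hat\beta_n-\beta_0\|=O_{\mathrm P}(|D_n|^{-1/2}+a_n)$. In particular $\|\hat\beta_n-\beta_0\|=O_{\mathrm P}(|D_n|^{-1/2})$ (root-$|D_n|$ consistency). -/

import Mathlib

open Set Filter Topology MeasureTheory Asymptotics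
open scoped Pointwise ENNReal

noncomputable section

namespace PenPP

/-- `d`-dimensional Euclidean space. -/
abbrev Sp (d : ℕ) : Type := EuclideanSpace ℝ (Fin d)

section PointProcess

variable {Ω : Type*} [MeasurableSpace Ω] {d : ℕ}

/-- `N(B)`, the number of points of the process in `B`. -/
def count (X : Ω → Set (Sp d)) (B : Set (Sp d)) (ω : Ω) : ℕ∞ := (X ω ∩ B).encard

/-- A (simple) point process on `ℝ^d`: a random subset of `ℝ^d` whose counts are random variables
and which has almost surely finitely many points in every bounded region. -/
structure IsPointProcess (P : Measure Ω) (X : Ω → Set (Sp d)) : Prop where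
  measurable_count : ∀ B : Set (Sp d), MeasurableSet B → Measurable (count X B)
  locally_finite : ∀ B : Set (Sp d), Bornology.IsBounded B → ∀ᵐ ω ∂P, (X ω ∩ B).Finite

/-- `ρ` is an intensity function of `X`: `E N(B) = ∫_B ρ(u) du` for all Borel sets `B`. -/
structure HasIntensity (P : Measure Ω) (X : Ω → Set (Sp d)) (ρ : Sp d → ℝ) : Prop where
  measurable : Measurable ρ
  nonneg : ∀ u, 0 ≤ ρ u
  moment : ∀ B : Set (Sp d), MeasurableSet B →
    ∫⁻ ω, (count X B ω : ℝ≥0∞) ∂P = ∫⁻ u in B, ENNReal.ofReal (ρ u)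

/-- `ρk` is a `k`-th order product density of `X`: it is a density of the `k`-th order factorial
moment measure `C ↦ E ∑^{≠}_{x_1, …, x_k ∈ X} 1[(x_1, …, x_k) ∈ C]`, the sum being over
pairwise different points. -/
structure IsProductDensity (P : Measure Ω) (X : Ω → Set (Sp d)) (k : ℕ)
    (ρk : (Fin k → Sp d) → ℝ) : Prop where
  measurable : Measurable ρk
  nonneg : ∀ x, 0 ≤ ρk x
  moment : ∀ C : Set (Fin k → Sp d), MeasurableSet C →
    ∫⁻ ω, (({x : Fin k → Sp d | Function.Injective x ∧ (∀ i, x i ∈ X ω) ∧ x ∈ C}.encard : ℕ∞) :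
      ℝ≥0∞) ∂P = ∫⁻ x in C, ENNReal.ofReal (ρk x)

/-- The σ-algebra `F(Λ)` on `Ω` generated by `X ∩ Λ`, i.e. by all counts `N(B ∩ Λ)`, `B` Borel. -/
@[reducible] def sigmaOf (X : Ω → Set (Sp d)) (Λ : Set (Sp d)) : MeasurableSpace Ω :=
  ⨆ B ∈ {B : Set (Sp d) | MeasurableSet B},
    MeasurableSpace.comap (count X (B ∩ Λ)) (inferInstance : MeasurableSpace ℕ∞)

/-- The strong mixing coefficient `α_{k,l}(q)`, `k, l ∈ ℕ ∪ {∞}`. -/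
def mixCoef (P : Measure Ω) (X : Ω → Set (Sp d)) (k l : ℕ∞) (q : ℝ) : ℝ :=
  sSup {r : ℝ | ∃ (Λ₁ Λ₂ : Set (Sp d)) (A B : Set Ω),
    MeasurableSet Λ₁ ∧ MeasurableSet Λ₂ ∧
    volume Λ₁ ≤ (k : ℝ≥0∞) ∧ volume Λ₂ ≤ (l : ℝ≥0∞) ∧
    (∀ x ∈ Λ₁, ∀ y ∈ Λ₂, q ≤ dist x y) ∧
    MeasurableSet[sigmaOf X Λ₁] A ∧ MeasurableSet[sigmaOf X Λ₂] B ∧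
    r = |P.real (A ∩ B) - P.real A * P.real B|}

end PointProcess

section Model

variable {d p : ℕ}

/-- The log-linear intensity `ρ(u; β) = exp(βᵀ z(u))`. -/
def rho (z : Sp d → Sp p) (β : Sp p) (u : Sp d) : ℝ := Real.exp (inner ℝ β (z u))

/-- The pair correlation function `g(u, v) = ρ⁽²⁾(u, v) / (ρ(u) ρ(v))`. -/
def pairCorr (z : Sp d → Sp p) (β : Sp p) (ρ₂ : (Fin 2 → Sp d) → ℝ) (u v : Sp d) : ℝ :=
  ρ₂ ![u, v] / (rho z β u * rho z β v)

/-- The observation domain `D_n = nE`. -/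
def dom (E : Set (Sp d)) (n : ℕ) : Set (Sp d) := (n : ℝ) • E

/-- The Lebesgue measure `|D_n|`. -/
def vol (E : Set (Sp d)) (n : ℕ) : ℝ := (volume : Measure (Sp d)).real (dom E n)

/-- `A_n(w; β) = ∫_{D} w(u) z(u) z(u)ᵀ ρ(u; β) du`. -/
def matA (z : Sp d → Sp p) (w : Sp d → ℝ) (β : Sp p) (D : Set (Sp d)) :
    Matrix (Fin p) (Fin p) ℝ :=
  Matrix.of fun i j => ∫ u in D, w u * (z u i * z u j) * rho z β u

/-- `B_n(w; β) = ∫_{D} w(u)² z(u) z(u)ᵀ ρ(u; β) du`. -/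
def matB (z : Sp d → Sp p) (w : Sp d → ℝ) (β : Sp p) (D : Set (Sp d)) :
    Matrix (Fin p) (Fin p) ℝ :=
  Matrix.of fun i j => ∫ u in D, w u ^ 2 * (z u i * z u j) * rho z β u

/-- `C_n(w; β) = ∫_{D} ∫_{D} w(u) w(v) z(u) z(v)ᵀ {g(u, v) - 1} ρ(u; β) ρ(v; β) dv du`. -/
def matC (z : Sp d → Sp p) (w : Sp d → ℝ) (β : Sp p) (ρ₂ : (Fin 2 → Sp d) → ℝ)
    (D : Set (Sp d)) : Matrix (Fin p) (Fin p) ℝ :=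
  Matrix.of fun i j => ∫ u in D, ∫ v in D,
    w u * w v * (z u i * z v j) * (pairCorr z β ρ₂ u v - 1) * rho z β u * rho z β v

/-- The weighted Poisson log-likelihood of the point pattern `x` observed on `D`,
`ℓ(w; β) = ∑_{u ∈ x ∩ D} w(u) log ρ(u; β) - ∫_D w(u) ρ(u; β) du`. -/
def loglik (z : Sp d → Sp p) (w : Sp d → ℝ) (D : Set (Sp d)) (x : Set (Sp d)) (β : Sp p) : ℝ :=
  (∑ᶠ u ∈ x ∩ D, w u * Real.log (rho z β u)) - ∫ u in D, w u * rho z β u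

/-- The penalized weighted Poisson log-likelihood
`Q(w; β) = ℓ(w; β) - |D| ∑_j p_{λ_j}(|β_j|)`; `pen l` is the penalty function `p_l`. -/
def penLoglik (z : Sp d → Sp p) (w : Sp d → ℝ) (D : Set (Sp d)) (pen : ℝ → ℝ → ℝ)
    (lam : Fin p → ℝ) (x : Set (Sp d)) (β : Sp p) : ℝ :=
  loglik z w D x β - (volume : Measure (Sp d)).real D * ∑ j, pen (lam j) |β j|

/-- The requirements on a single penalty function. Only its values on `[0, ∞)` matter. -/
structure IsPenalty (f : ℝ → ℝ) : Prop where
  nonneg : ∀ θ, 0 ≤ θ → 0 ≤ f θ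
  zero : f 0 = 0
  contDiff : ContDiffOn ℝ 1 f (Ioi 0)
  lipschitz_deriv : ∃ L, LipschitzOnWith L (deriv f) (Ioi 0)

/-- `a_n = max_{j = 1, …, s} |p'_{λ_{n,j}}(|β_{0j}|)|` (equal to `0` if `s = 0`). -/
def seqA (pen : ℝ → ℝ → ℝ) (lam : ℕ → Fin p → ℝ) (β₀ : Sp p) (s : ℕ) (n : ℕ) : ℝ :=
  ⨆ j : {j : Fin p // (j : ℕ) < s}, |deriv (pen (lam n j)) (|β₀ j|)|

/-- `c_n = max_{j = 1, …, s} |p''_{λ_{n,j}}(|β_{0j}|)|` (equal to `0` if `s = 0`). -/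
def seqC (pen : ℝ → ℝ → ℝ) (lam : ℕ → Fin p → ℝ) (β₀ : Sp p) (s : ℕ) (n : ℕ) : ℝ :=
  ⨆ j : {j : Fin p // (j : ℕ) < s}, |iteratedDeriv 2 (pen (lam n j)) (|β₀ j|)|

end Model

/-- `Y_n = O_P(r_n)` as `n → ∞`. -/
def IsBigOP {Ω : Type*} [MeasurableSpace Ω] (P : Measure Ω) (Y : ℕ → Ω → ℝ) (r : ℕ → ℝ) : Prop :=
  ∀ ε : ℝ, 0 < ε → ∃ M : ℝ, ∀ᶠ n in atTop, P {ω | M * r n < |Y n ω|} ≤ ENNReal.ofReal ε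

end PenPP

end

noncomputable section

namespace PenPP

section PointMeasure

variable {Ω : Type*} {d : ℕ}

/-- The counting measure carried by a realization of the point process. -/
def pts (X : Ω → Set (Sp d)) (ω : Ω) : Measure (Sp d) := Measure.count.restrict (X ω)

lemma measure_count_eq_encard {α : Type*} [MeasurableSpace α] [MeasurableSingletonClass α]
    (s : Set α) : Measure.count s = (s.encard : ℝ≥0∞) := by
  rcases s.finite_or_infinite with h | h
  · rw [Measure.count_apply h.measurableSet]
  · rw [Measure.count_apply_infinite h, h.encard_eq]; rfl

lemma pts_apply (X : Ω → Set (Sp d)) (ω : Ω) {B : Set (Sp d)} (hB : MeasurableSet B) :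
    pts X ω B = (count X B ω : ℝ≥0∞) := by
  rw [pts, Measure.restrict_apply hB, measure_count_eq_encard, count, inter_comm]

lemma sigmaOf_le [MeasurableSpace Ω] {P : Measure Ω} {X : Ω → Set (Sp d)} (hX : IsPointProcess P X)
    {Λ : Set (Sp d)} (hΛ : MeasurableSet Λ) : sigmaOf X Λ ≤ ‹MeasurableSpace Ω› := by
  refine iSup₂_le fun B hB => ?_
  exact (hX.measurable_count _ (MeasurableSet.inter hB hΛ)).comap_le

lemma measurable_count_sigmaOf (X : Ω → Set (Sp d)) (Λ : Set (Sp d)) {B : Set (Sp d)}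
    (hB : MeasurableSet B) : Measurable[sigmaOf X Λ] (count X (B ∩ Λ)) := by
  have h : MeasurableSpace.comap (count X (B ∩ Λ)) inferInstance ≤ sigmaOf X Λ :=
    le_iSup₂_of_le (f := fun B (_ : B ∈ {B : Set (Sp d) | MeasurableSet B}) =>
      MeasurableSpace.comap (count X (B ∩ Λ)) (inferInstance : MeasurableSpace ℕ∞)) B hB le_rfl
  exact Measurable.of_comap_le h

lemma measurable_setLIntegral_pts (X : Ω → Set (Sp d)) {Λ : Set (Sp d)} (hΛ : MeasurableSet Λ)
    {f : Sp d → ℝ≥0∞} (hf : Measurable f) :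
    Measurable[sigmaOf X Λ] fun ω => ∫⁻ u in Λ, f u ∂(pts X ω) := by
  have h : Measurable[sigmaOf X Λ] fun ω => (pts X ω).restrict Λ := by
    refine @Measure.measurable_of_measurable_coe _ _ _ (sigmaOf X Λ) _ fun B hB => ?_
    simp_rw [Measure.restrict_apply hB, pts_apply X _ (hB.inter hΛ)]
    exact (measurable_from_top (f := fun n : ℕ∞ => (n : ℝ≥0∞))).comp
      (measurable_count_sigmaOf X Λ hB)
  exact (Measure.measurable_lintegral hf).comp h

lemma measurable_pts [MeasurableSpace Ω] {P : Measure Ω} {X : Ω → Set (Sp d)} (hX : IsPointProcess P X) :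
    Measurable fun ω => pts X ω := by
  refine Measure.measurable_of_measurable_coe _ fun B hB => ?_
  simp_rw [pts_apply X _ hB]
  exact (measurable_from_top (f := fun n : ℕ∞ => (n : ℝ≥0∞))).comp (hX.measurable_count B hB)

/-- Campbell's formula. -/
lemma lintegral_lintegral_pts [MeasurableSpace Ω] {P : Measure Ω} {X : Ω → Set (Sp d)} (hX : IsPointProcess P X)
    {r : Sp d → ℝ} (hr : HasIntensity P X r) {f : Sp d → ℝ≥0∞} (hf : Measurable f)
    {D : Set (Sp d)} (hD : MeasurableSet D) :
    ∫⁻ ω, ∫⁻ u in D, f u ∂(pts X ω) ∂P = ∫⁻ u in D, f u * ENNReal.ofReal (r u) := by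
  have hb : P.bind (pts X) = volume.withDensity fun u => ENNReal.ofReal (r u) := by
    ext B hB
    rw [Measure.bind_apply hB (measurable_pts hX).aemeasurable, withDensity_apply _ hB,
      ← hr.moment B hB]
    simp_rw [pts_apply X _ hB]
  simp_rw [← lintegral_indicator hD]
  rw [← Measure.lintegral_bind (measurable_pts hX).aemeasurable
    (hf.indicator hD).aemeasurable, hb,
    lintegral_withDensity_eq_lintegral_mul _ hr.measurable.ennreal_ofReal (hf.indicator hD)]
  refine lintegral_congr fun u => ?_
  by_cases hu : u ∈ D <;> simp [hu, mul_comm]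

lemma toReal_setLIntegral_pts {X : Ω → Set (Sp d)} {ω : Ω} {D : Set (Sp d)}
    (hD : MeasurableSet D) (hfin : (X ω ∩ D).Finite) (f : Sp d → ℝ) :
    (∫⁻ u in D, ENNReal.ofReal (f u) ∂(pts X ω)).toReal = ∑ u ∈ hfin.toFinset, max (f u) 0 := by
  have h : (pts X ω).restrict D = Measure.count.restrict (hfin.toFinset : Set (Sp d)) := by
    rw [pts, Measure.restrict_restrict hD, inter_comm, hfin.coe_toFinset]
  rw [h, lintegral_finset, ENNReal.toReal_sum (by simp)]
  simp [ENNReal.toReal_ofReal']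

lemma pow_le_mul_descFactorial (m N : ℕ) : N ^ m ≤ m ^ m * (1 + N.descFactorial m) := by
  rcases lt_or_ge N m with h | h
  · calc N ^ m ≤ m ^ m := Nat.pow_le_pow_left h.le m
      _ ≤ m ^ m * (1 + N.descFactorial m) := Nat.le_mul_of_pos_right _ (by omega)
  · have h1 : (N + 1 - m) ^ m ≤ N.descFactorial m := Nat.pow_sub_le_descFactorial N m
    have h2 : N ≤ m * (N + 1 - m) ∨ m = 0 := by
      rcases Nat.eq_zero_or_pos m with h0 | h0
      · exact Or.inr h0
      · left
        obtain ⟨k, rfl⟩ := Nat.exists_eq_add_of_le h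
        have : m + k + 1 - m = k + 1 := by omega
        rw [this]
        nlinarith
    rcases h2 with h2 | rfl
    · calc N ^ m ≤ (m * (N + 1 - m)) ^ m := Nat.pow_le_pow_left h2 m
        _ = m ^ m * (N + 1 - m) ^ m := mul_pow _ _ _
        _ ≤ m ^ m * (1 + N.descFactorial m) := Nat.mul_le_mul_left _ (by omega)
    · simp

lemma encard_injective_tuples {α : Type*} {S : Set α} (hS : S.Finite) (m : ℕ) :
    {x : Fin m → α | Function.Injective x ∧ ∀ i, x i ∈ S}.encard =
      (S.ncard.descFactorial m : ℕ) := by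
  classical
  have := hS.fintype
  have e : {x : Fin m → α | Function.Injective x ∧ ∀ i, x i ∈ S} ≃ (Fin m ↪ S) :=
    { toFun := fun x => ⟨fun i => ⟨x.1 i, x.2.2 i⟩, fun i j h => x.2.1 (congrArg Subtype.val h)⟩
      invFun := fun y => ⟨fun i => (y i).1,
        fun i j h => y.injective (Subtype.ext h), fun i => (y i).2⟩
      left_inv := fun x => rfl
      right_inv := fun y => rfl }
  rw [encard, ENat.card_congr (β := Fin m ↪ S) e, ENat.card_eq_coe_fintype_card,
    Fintype.card_embedding_eq, Fintype.card_fin, Set.ncard_eq_toFinset_card',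
    Set.toFinset_card]

lemma lintegral_count_pow_le [MeasurableSpace Ω] {P : Measure Ω} [IsProbabilityMeasure P] {X : Ω → Set (Sp d)}
    (hX : IsPointProcess P X) {m : ℕ} {r : (Fin m → Sp d) → ℝ} (hr : IsProductDensity P X m r)
    {K : ℝ} (hK : ∀ x, r x ≤ K) {B : Set (Sp d)} (hB : MeasurableSet B)
    (hbdd : Bornology.IsBounded B) (hvol : volume B ≤ 1) :
    ∫⁻ ω, (count X B ω : ℝ≥0∞) ^ m ∂P ≤ (m : ℝ≥0∞) ^ m * (1 + ENNReal.ofReal K) := by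
  set C : Set (Fin m → Sp d) := Set.pi univ fun _ => B
  have hC : MeasurableSet C := MeasurableSet.univ_pi fun _ => hB
  set F : Ω → ℝ≥0∞ := fun ω => (({x : Fin m → Sp d | Function.Injective x ∧
    (∀ i, x i ∈ X ω) ∧ x ∈ C}.encard : ℕ∞) : ℝ≥0∞)
  have h1 : ∫⁻ ω, F ω ∂P ≤ ENNReal.ofReal K := by
    rw [hr.moment C hC]
    calc ∫⁻ x in C, ENNReal.ofReal (r x) ≤ ∫⁻ x in C, ENNReal.ofReal K := by
          gcongr with x; exact hK x
      _ = ENNReal.ofReal K * volume C := by simp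
      _ ≤ ENNReal.ofReal K * 1 := by
          gcongr
          rw [volume_pi_pi]
          exact Finset.prod_le_one' fun i _ => hvol
      _ = ENNReal.ofReal K := mul_one _
  have h2 : ∀ᵐ ω ∂P, (count X B ω : ℝ≥0∞) ^ m ≤ (m : ℝ≥0∞) ^ m * (1 + F ω) := by
    filter_upwards [hX.locally_finite B hbdd] with ω hω
    have hF : F ω = ((X ω ∩ B).ncard.descFactorial m : ℕ) := by
      have hset : {x : Fin m → Sp d | Function.Injective x ∧ (∀ i, x i ∈ X ω) ∧ x ∈ C} =
          {x | Function.Injective x ∧ ∀ i, x i ∈ X ω ∩ B} := by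
        ext x; simp [C, forall_and]
      simp only [F]
      rw [hset, encard_injective_tuples hω]
      simp
    have hc : (count X B ω : ℝ≥0∞) = ((X ω ∩ B).ncard : ℕ) := by
      rw [count, ← hω.cast_ncard_eq]; simp
    rw [hF, hc]
    exact_mod_cast pow_le_mul_descFactorial m _
  calc ∫⁻ ω, (count X B ω : ℝ≥0∞) ^ m ∂P ≤ ∫⁻ ω, (m : ℝ≥0∞) ^ m * (1 + F ω) ∂P :=
        lintegral_mono_ae h2
    _ = (m : ℝ≥0∞) ^ m * (1 + ∫⁻ ω, F ω ∂P) := by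
        rw [lintegral_const_mul' _ _ (by finiteness), lintegral_add_left measurable_const]
        simp
    _ ≤ _ := by gcongr

lemma lintegral_setLIntegral_pts_pow_le [MeasurableSpace Ω] {P : Measure Ω} [IsProbabilityMeasure P]
    {X : Ω → Set (Sp d)}
    (hX : IsPointProcess P X) {m : ℕ} {r : (Fin m → Sp d) → ℝ} (hr : IsProductDensity P X m r)
    {K : ℝ} (hK : ∀ x, r x ≤ K) {B : Set (Sp d)} (hB : MeasurableSet B)
    (hbdd : Bornology.IsBounded B) (hvol : volume B ≤ 1) {f : Sp d → ℝ≥0∞} {κ : ℝ≥0∞}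
    (hκ : κ ≠ ∞) (hf : ∀ u, f u ≤ κ) :
    ∫⁻ ω, (∫⁻ u in B, f u ∂(pts X ω)) ^ m ∂P ≤
      κ ^ m * ((m : ℝ≥0∞) ^ m * (1 + ENNReal.ofReal K)) := by
  calc ∫⁻ ω, (∫⁻ u in B, f u ∂(pts X ω)) ^ m ∂P
      ≤ ∫⁻ ω, κ ^ m * (count X B ω : ℝ≥0∞) ^ m ∂P := by
        refine lintegral_mono fun ω => ?_
        rw [← mul_pow]
        gcongr
        calc ∫⁻ u in B, f u ∂(pts X ω) ≤ ∫⁻ _ in B, κ ∂(pts X ω) := by gcongr with u; exact hf u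
          _ = κ * (count X B ω : ℝ≥0∞) := by simp [pts_apply X ω hB]
    _ = κ ^ m * ∫⁻ ω, (count X B ω : ℝ≥0∞) ^ m ∂P := lintegral_const_mul' _ _ (by finiteness)
    _ ≤ _ := by gcongr; exact lintegral_count_pow_le hX hr hK hB hbdd hvol

end PointMeasure

section Covariance

variable {Ω : Type*}

lemma integrableOn_measureReal_le [MeasurableSpace Ω] (μ : Measure Ω) [IsFiniteMeasure μ] (Y : Ω → ℝ) (M : ℝ) :
    IntegrableOn (fun t => μ.real {ω | t ≤ Y ω}) (Ioc 0 M) := by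
  have h : Antitone fun t => μ.real {ω | t ≤ Y ω} := fun s t hst =>
    measureReal_mono fun ω (hω : t ≤ Y ω) => hst.trans hω
  exact ((h.antitoneOn _).integrableOn_isCompact isCompact_Icc).mono_set Ioc_subset_Icc_self

lemma abs_integral_sub_le_of_measure {m m₀ : MeasurableSpace Ω} (hm : m ≤ m₀) {μ ν : Measure Ω}
    [IsFiniteMeasure μ] [IsFiniteMeasure ν] {c κ M : ℝ}
    (h : ∀ B, MeasurableSet[m] B → |μ.real B - c * ν.real B| ≤ κ) {Y : Ω → ℝ}
    (hY : Measurable[m] Y) (hY0 : ∀ ω, 0 ≤ Y ω) (hM : 0 ≤ M) (hYM : ∀ ω, Y ω ≤ M) :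
    |∫ ω, Y ω ∂μ - c * ∫ ω, Y ω ∂ν| ≤ M * κ := by
  have hint : ∀ (μ : Measure Ω) [IsFiniteMeasure μ], Integrable Y μ := fun μ _ =>
    Integrable.of_bound (hY.mono hm le_rfl).aestronglyMeasurable M
      (ae_of_all _ fun ω => by rw [Real.norm_of_nonneg (hY0 ω)]; exact hYM ω)
  rw [(hint μ).integral_eq_integral_Ioc_meas_le (ae_of_all _ hY0) (ae_of_all _ hYM),
    (hint ν).integral_eq_integral_Ioc_meas_le (ae_of_all _ hY0) (ae_of_all _ hYM),
    ← integral_const_mul, ← integral_sub (integrableOn_measureReal_le μ Y M)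
      ((integrableOn_measureReal_le ν Y M).const_mul c), ← Real.norm_eq_abs]
  refine (norm_setIntegral_le_of_norm_le_const (C := κ) (by simp) fun t _ => ?_).trans ?_
  · exact h _ (hY measurableSet_Ici)
  · simp [hM, mul_comm]

/-- The covariance inequality for bounded nonnegative random variables under strong mixing. -/
lemma abs_cov_le_of_bounded {m₁ m₂ m₀ : MeasurableSpace Ω} {P : Measure Ω} [IsProbabilityMeasure P]
    (h₁ : m₁ ≤ m₀) (h₂ : m₂ ≤ m₀) {a M : ℝ}
    (h : ∀ A B, MeasurableSet[m₁] A → MeasurableSet[m₂] B →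
      |P.real (A ∩ B) - P.real A * P.real B| ≤ a) {X Y : Ω → ℝ} (hM : 0 ≤ M)
    (hX : Measurable[m₁] X) (hX0 : ∀ ω, 0 ≤ X ω) (hXM : ∀ ω, X ω ≤ M)
    (hY : Measurable[m₂] Y) (hY0 : ∀ ω, 0 ≤ Y ω) (hYM : ∀ ω, Y ω ≤ M) :
    |∫ ω, X ω * Y ω ∂P - (∫ ω, X ω ∂P) * ∫ ω, Y ω ∂P| ≤ M ^ 2 * a := by
  have hX' : Measurable[m₀] X := hX.mono h₁ le_rfl
  have hXint : Integrable X P := Integrable.of_bound hX'.aestronglyMeasurable M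
      (ae_of_all _ fun ω => by rw [Real.norm_of_nonneg (hX0 ω)]; exact hXM ω)
  set ν : Measure Ω := P.withDensity fun ω => ENNReal.ofReal (X ω) with hν
  have hνfin : IsFiniteMeasure ν :=
    isFiniteMeasure_withDensity_ofReal hXint.2
  have hνint : ∀ g : Ω → ℝ, ∫ ω, g ω ∂ν = ∫ ω, X ω * g ω ∂P := fun g => by
    rw [hν, integral_withDensity_eq_integral_toReal_smul hX'.ennreal_ofReal (by simp)]
    simp [hX0]
  have hνreal : ∀ B, MeasurableSet[m₀] B → ν.real B = ∫ ω in B, X ω ∂P := fun B hB => by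
    rw [measureReal_def, hν, withDensity_apply _ hB,
      integral_eq_lintegral_of_nonneg_ae (ae_of_all _ hX0) hX'.aestronglyMeasurable]
  have hstep : ∀ B, MeasurableSet[m₂] B → |ν.real B - (∫ ω, X ω ∂P) * P.real B| ≤ M * a := by
    intro B hB
    rw [hνreal B (h₂ _ hB), mul_comm]
    refine abs_integral_sub_le_of_measure h₁ (fun A hA => ?_) hX hX0 hM hXM
    have := h A B hA hB
    rw [measureReal_restrict_apply (h₁ _ hA), mul_comm (P.real B)]
    exact this
  have := abs_integral_sub_le_of_measure h₂ hstep hY hY0 hM hYM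
  rw [hνint] at this
  rwa [pow_two, mul_assoc]

lemma mul_le_min_mul_min_add {x y M : ℝ} {t : ℕ} (hx : 0 ≤ x) (hy : 0 ≤ y) (hM : 0 < M) :
    x * y ≤ min x M * min y M + 2 * (M ^ t)⁻¹ * (x ^ (2 + t) + y ^ (2 + t)) := by
  have hMt : 0 < (M ^ t)⁻¹ := by positivity
  have key : ∀ a b : ℝ, 0 ≤ a → 0 ≤ b → M ≤ a →
      a * b ≤ (M ^ t)⁻¹ * (a ^ (2 + t) + b ^ (2 + t)) := by
    intro a b ha hb hab
    have h1 : 1 ≤ (M ^ t)⁻¹ * a ^ t := by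
      rw [inv_mul_eq_div, one_le_div (by positivity)]
      exact pow_le_pow_left₀ hM.le hab t
    have h2 : a * b * a ^ t ≤ a ^ (2 + t) + b ^ (2 + t) := by
      rcases le_total a b with hle | hle
      · have : a * b * a ^ t ≤ b * b * b ^ t := by gcongr
        have h3 : b * b * b ^ t = b ^ (2 + t) := by ring
        have : 0 ≤ a ^ (2 + t) := by positivity
        linarith
      · have : a * b * a ^ t ≤ a * a * a ^ t := by gcongr
        have h3 : a * a * a ^ t = a ^ (2 + t) := by ring
        have : 0 ≤ b ^ (2 + t) := by positivity
        linarith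
    calc a * b ≤ a * b * ((M ^ t)⁻¹ * a ^ t) := le_mul_of_one_le_right (by positivity) h1
      _ = (M ^ t)⁻¹ * (a * b * a ^ t) := by ring
      _ ≤ _ := by gcongr
  have hpos : 0 ≤ (M ^ t)⁻¹ * (x ^ (2 + t) + y ^ (2 + t)) := by positivity
  have hmin : 0 ≤ min x M * min y M := by positivity
  rcases le_total x M with h1 | h1
  · rcases le_total y M with h2 | h2
    · rw [min_eq_left h1, min_eq_left h2]; linarith
    · have := key y x hy hx h2
      rw [mul_comm y, add_comm] at this
      linarith
  · have := key x y hx hy h1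
    linarith

/-- An upper bound for the covariance of nonnegative random variables under strong mixing,
with a free truncation level `M`. -/
lemma integral_mul_sub_le_of_mixing {m₁ m₂ m₀ : MeasurableSpace Ω} {P : Measure Ω}
    [IsProbabilityMeasure P] (h₁ : m₁ ≤ m₀) (h₂ : m₂ ≤ m₀) {a M K : ℝ} {t : ℕ}
    (h : ∀ A B, MeasurableSet[m₁] A → MeasurableSet[m₂] B →
      |P.real (A ∩ B) - P.real A * P.real B| ≤ a) {X Y : Ω → ℝ} (hM : 0 < M)
    (hX : Measurable[m₁] X) (hX0 : ∀ ω, 0 ≤ X ω) (hY : Measurable[m₂] Y) (hY0 : ∀ ω, 0 ≤ Y ω)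
    (hX1 : Integrable X P) (hY1 : Integrable Y P)
    (hXi : Integrable (fun ω => X ω ^ (2 + t)) P) (hYi : Integrable (fun ω => Y ω ^ (2 + t)) P)
    (hXK : ∫ ω, X ω ^ (2 + t) ∂P ≤ K) (hYK : ∫ ω, Y ω ^ (2 + t) ∂P ≤ K) :
    ∫ ω, X ω * Y ω ∂P - (∫ ω, X ω ∂P) * ∫ ω, Y ω ∂P ≤ M ^ 2 * a + 4 * K * (M ^ t)⁻¹ := by
  have hX' : Measurable[m₀] X := hX.mono h₁ le_rfl
  have hY' : Measurable[m₀] Y := hY.mono h₂ le_rfl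
  have hb := abs_cov_le_of_bounded h₁ h₂ h hM.le (X := fun ω => min (X ω) M)
    (Y := fun ω => min (Y ω) M) (hX.min measurable_const) (fun ω => le_min (hX0 ω) hM.le)
    (fun ω => min_le_right _ _) (hY.min measurable_const) (fun ω => le_min (hY0 ω) hM.le)
    (fun ω => min_le_right _ _)
  have hXm : Integrable (fun ω => min (X ω) M) P := hX1.inf (integrable_const M)
  have hYm : Integrable (fun ω => min (Y ω) M) P := hY1.inf (integrable_const M)
  have hXYm : Integrable (fun ω => min (X ω) M * min (Y ω) M) P :=
    hYm.bdd_mul hXm.aestronglyMeasurable (c := M) (ae_of_all _ fun ω => by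
      rw [Real.norm_of_nonneg (le_min (hX0 ω) hM.le)]; exact min_le_right _ _)
  have hR : Integrable (fun ω => min (X ω) M * min (Y ω) M +
      2 * (M ^ t)⁻¹ * (X ω ^ (2 + t) + Y ω ^ (2 + t))) P :=
    hXYm.add ((hXi.add hYi).const_mul _)
  have hle : ∀ ω, X ω * Y ω ≤ min (X ω) M * min (Y ω) M +
      2 * (M ^ t)⁻¹ * (X ω ^ (2 + t) + Y ω ^ (2 + t)) := fun ω =>
    mul_le_min_mul_min_add (hX0 ω) (hY0 ω) hM
  have hE : ∫ ω, X ω * Y ω ∂P ≤ ∫ ω, min (X ω) M * min (Y ω) M ∂P +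
      2 * (M ^ t)⁻¹ * (∫ ω, X ω ^ (2 + t) ∂P + ∫ ω, Y ω ^ (2 + t) ∂P) := by
    have hsum : Integrable (fun ω => 2 * (M ^ t)⁻¹ * (X ω ^ (2 + t) + Y ω ^ (2 + t))) P :=
      (hXi.add hYi).const_mul _
    rw [← integral_add hXi hYi, ← integral_const_mul, ← integral_add hXYm hsum]
    exact integral_mono_of_nonneg (ae_of_all _ fun ω => mul_nonneg (hX0 ω) (hY0 ω)) hR
      (ae_of_all _ hle)
  have hE2 : 2 * (M ^ t)⁻¹ * (∫ ω, X ω ^ (2 + t) ∂P + ∫ ω, Y ω ^ (2 + t) ∂P) ≤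
      2 * (M ^ t)⁻¹ * (K + K) := by gcongr
  have hprod : (∫ ω, min (X ω) M ∂P) * ∫ ω, min (Y ω) M ∂P ≤
      (∫ ω, X ω ∂P) * ∫ ω, Y ω ∂P :=
    mul_le_mul (integral_mono hXm hX1 fun ω => min_le_left _ _)
      (integral_mono hYm hY1 fun ω => min_le_left _ _)
      (integral_nonneg fun ω => le_min (hY0 ω) hM.le) (integral_nonneg hX0)
  have := (abs_le.1 hb).2
  linarith

end Covariance

section Lattice

variable {d : ℕ}

/-- The half-open unit cube with lower corner `k`. -/
def cell (k : Fin d → ℤ) : Set (Sp d) := {u | ∀ i, ⌊u i⌋ = k i}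

lemma cell_eq_preimage (k : Fin d → ℤ) :
    cell k = WithLp.ofLp ⁻¹' Set.pi univ fun i => Ico (k i : ℝ) (k i + 1) := by
  ext u
  simp [cell, Int.floor_eq_iff]

lemma measurableSet_cell (k : Fin d → ℤ) : MeasurableSet (cell k) := by
  rw [cell_eq_preimage]
  exact (PiLp.volume_preserving_ofLp (Fin d)).measurable
    (MeasurableSet.univ_pi fun _ => measurableSet_Ico)

lemma volume_cell (k : Fin d → ℤ) : volume (cell k) = 1 := by
  rw [cell_eq_preimage, (PiLp.volume_preserving_ofLp (Fin d)).measure_preimage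
    (MeasurableSet.univ_pi fun _ => measurableSet_Ico).nullMeasurableSet, volume_pi_pi]
  simp

lemma isBounded_cell (k : Fin d → ℤ) : Bornology.IsBounded (cell k) := by
  have hc : IsCompact (WithLp.toLp 2 '' Set.pi univ fun i => Icc (k i : ℝ) (k i + 1) :
      Set (Sp d)) :=
    (isCompact_univ_pi fun _ => isCompact_Icc).image (PiLp.continuous_toLp 2 _)
  refine hc.isBounded.subset fun u hu => ⟨WithLp.ofLp u, ?_, rfl⟩
  rw [cell_eq_preimage] at hu
  exact fun i hi => Ico_subset_Icc_self (hu i hi)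

lemma norm_sub_sub_one_le_dist {k l : Fin d → ℤ} {x y : Sp d} (hx : x ∈ cell k)
    (hy : y ∈ cell l) : ‖k - l‖ - 1 ≤ dist x y := by
  have h : ‖k - l‖ ≤ dist x y + 1 := by
    refine (pi_norm_le_iff_of_nonneg (by positivity)).2 fun i => ?_
    have h1 : |x i - y i| ≤ dist x y := by
      rw [dist_eq_norm]
      simpa using PiLp.norm_apply_le (x - y) i
    have hxi := hx i
    have hyi := hy i
    rw [Int.floor_eq_iff] at hxi hyi
    rw [Pi.sub_apply, Int.norm_eq_abs]
    push_cast
    rw [abs_le] at h1 ⊢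
    constructor <;> linarith
  linarith

lemma pairwise_disjoint_cell : Pairwise (Function.onFun Disjoint (cell (d := d))) := by
  intro k l hkl
  refine Set.disjoint_left.2 fun u hk hl => hkl (funext fun i => ?_)
  rw [← hk i, hl i]

lemma subset_biUnion_cell {D : Set (Sp d)} {m : ℕ} (hD : ∀ u ∈ D, ‖u‖ ≤ m) :
    D ⊆ ⋃ k ∈ Fintype.piFinset fun _ : Fin d => Finset.Icc (-m : ℤ) m, cell k := by
  intro u hu
  refine mem_iUnion₂.2 ⟨fun i => ⌊u i⌋, ?_, fun i => rfl⟩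
  refine Fintype.mem_piFinset.2 fun i => Finset.mem_Icc.2 ?_
  have h : |u i| ≤ m := by simpa using (PiLp.norm_apply_le u i).trans (hD u hu)
  rw [abs_le] at h
  refine ⟨Int.le_floor.2 (by push_cast; exact h.1), ?_⟩
  have h2 : ((⌊u i⌋ : ℤ) : ℝ) ≤ ((m : ℤ) : ℝ) := by
    push_cast
    exact (Int.floor_le (u i)).trans h.2
  exact Int.cast_le.1 h2

lemma card_piFinset_Icc_le {m : ℕ} (hm : 1 ≤ m) :
    ((Fintype.piFinset fun _ : Fin d => Finset.Icc (-m : ℤ) m).card : ℝ) ≤ 3 ^ d * (m : ℝ) ^ d := by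
  rw [Fintype.card_piFinset_const, Int.card_Icc]
  have : ((m : ℤ) + 1 - (-m)).toNat = 2 * m + 1 := by omega
  rw [this, ← mul_pow]
  push_cast
  have : (1 : ℝ) ≤ m := by exact_mod_cast hm
  gcongr
  linarith

lemma summable_norm_rpow_int {τ : ℝ} (hτ : (d : ℝ) < τ) :
    Summable fun h : Fin d → ℤ => ‖h‖ ^ (-τ) := by
  set b := Pi.basisFun ℝ (Fin d)
  set L := Submodule.span ℤ (Set.range b)
  have hrank : Module.finrank ℤ L = d := by
    rw [ZLattice.rank ℝ L]; simp
  have hs := ZLattice.summable_norm_rpow L (-τ) (by rw [hrank]; linarith)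
  have hmem : ∀ h : Fin d → ℤ, (fun i => (h i : ℝ)) ∈ L := fun h => by
    rw [Module.Basis.mem_span_iff_repr_mem]
    exact fun i => ⟨h i, by simp [b]⟩
  let e : (Fin d → ℤ) → L := fun h => ⟨fun i => (h i : ℝ), hmem h⟩
  have he : Function.Injective e := fun h h' hh => funext fun i => by
    have : (h i : ℝ) = h' i := congrFun (congrArg Subtype.val hh) i
    exact Int.cast_injective this
  refine (hs.comp_injective he).congr fun h => ?_
  have : ‖e h‖ = ‖h‖ := by
    rw [Submodule.coe_norm]
    simp only [Pi.norm_def, e]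
    congr
  rw [Function.comp_apply, this]

/-- The rate at which covariances between unit cubes decay in terms of their relative position. -/
def latticeRate (τ : ℝ) (h : Fin d → ℤ) : ℝ := if h = 0 then 1 else ‖h‖ ^ (-τ)

lemma latticeRate_nonneg (τ : ℝ) (h : Fin d → ℤ) : 0 ≤ latticeRate τ h := by
  rw [latticeRate]; split_ifs <;> positivity

lemma summable_latticeRate {τ : ℝ} (hτ : (d : ℝ) < τ) :
    Summable (latticeRate (d := d) τ) := by
  have h0 : Summable fun h : Fin d → ℤ => if h = 0 then (1 : ℝ) else 0 :=
    summable_of_ne_finset_zero (s := {0}) fun h hh => by simpa using hh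
  refine Summable.of_nonneg_of_le (latticeRate_nonneg τ) (fun h => ?_)
    (h0.add (summable_norm_rpow_int hτ))
  rw [latticeRate]
  split_ifs
  · have : 0 ≤ ‖h‖ ^ (-τ) := by positivity
    linarith
  · simp

lemma sum_sum_latticeRate_le {τ : ℝ} (hτ : (d : ℝ) < τ) (I : Finset (Fin d → ℤ)) :
    ∑ k ∈ I, ∑ l ∈ I, latticeRate τ (k - l) ≤ I.card * ∑' h, latticeRate (d := d) τ h := by
  rw [← nsmul_eq_mul]
  refine Finset.sum_le_card_nsmul _ _ _ fun k _ => ?_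
  have h1 := ((Equiv.subLeft k).summable_iff.2 (summable_latticeRate hτ)).sum_le_tsum I
    fun l _ => latticeRate_nonneg _ _
  rw [(Equiv.subLeft k).tsum_eq (latticeRate τ)] at h1
  simp only [Equiv.subLeft_apply] at h1
  exact h1

end Lattice

section Variance

section

variable {Ω : Type*} {d : ℕ}

/-- The contribution of the points in the unit cube `k` to a linear statistic. -/
def cellSum (X : Ω → Set (Sp d)) (g : Sp d → ℝ≥0∞) (k : Fin d → ℤ) (ω : Ω) : ℝ :=
  (∫⁻ u in cell k, g u ∂(pts X ω)).toReal

lemma cellSum_nonneg (X : Ω → Set (Sp d)) (g : Sp d → ℝ≥0∞) (k : Fin d → ℤ) (ω : Ω) :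
    0 ≤ cellSum X g k ω := ENNReal.toReal_nonneg

lemma measurable_cellSum (X : Ω → Set (Sp d)) {g : Sp d → ℝ≥0∞} (hg : Measurable g)
    (k : Fin d → ℤ) : Measurable[sigmaOf X (cell k)] (cellSum X g k) :=
  ENNReal.measurable_toReal.comp (measurable_setLIntegral_pts X (measurableSet_cell k) hg)

end

variable {Ω : Type*} [MeasurableSpace Ω] {d : ℕ}

lemma abs_sub_le_mixCoef (P : Measure Ω) [IsProbabilityMeasure P] (X : Ω → Set (Sp d))
    (k l : ℕ∞) {q : ℝ} {Λ₁ Λ₂ : Set (Sp d)} (h₁ : MeasurableSet Λ₁) (h₂ : MeasurableSet Λ₂)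
    (hk : volume Λ₁ ≤ (k : ℝ≥0∞)) (hl : volume Λ₂ ≤ (l : ℝ≥0∞))
    (hq : ∀ x ∈ Λ₁, ∀ y ∈ Λ₂, q ≤ dist x y) {A B : Set Ω}
    (hA : MeasurableSet[sigmaOf X Λ₁] A) (hB : MeasurableSet[sigmaOf X Λ₂] B) :
    |P.real (A ∩ B) - P.real A * P.real B| ≤ mixCoef P X k l q := by
  refine le_csSup ⟨1, ?_⟩ ⟨Λ₁, Λ₂, A, B, h₁, h₂, hk, hl, hq, hA, hB, rfl⟩
  rintro r ⟨_, _, A, B, -, -, -, -, -, -, -, rfl⟩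
  have h1 : P.real (A ∩ B) ≤ 1 := measureReal_le_one
  have h2 : P.real A * P.real B ≤ 1 :=
    mul_le_one₀ measureReal_le_one measureReal_nonneg measureReal_le_one
  have h3 : 0 ≤ P.real (A ∩ B) := measureReal_nonneg
  have h4 : 0 ≤ P.real A * P.real B := by positivity
  rw [abs_le]; constructor <;> linarith

lemma pow_le_one_add_pow {x : ℝ} (hx : 0 ≤ x) {i m : ℕ} (him : i ≤ m) : x ^ i ≤ 1 + x ^ m := by
  have : 0 ≤ x ^ m := by positivity
  rcases le_total x 1 with h | h
  · have := pow_le_one₀ (n := i) hx h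
    linarith
  · have := pow_le_pow_right₀ h him
    linarith

lemma integrable_cellSum_pow {P : Measure Ω} [IsProbabilityMeasure P] {X : Ω → Set (Sp d)}
    (hX : IsPointProcess P X) {m : ℕ} (hm : m ≠ 0) {r : (Fin m → Sp d) → ℝ}
    (hr : IsProductDensity P X m r) {K : ℝ} (hK : ∀ x, r x ≤ K) {g : Sp d → ℝ≥0∞}
    (hg : Measurable g) {κ : ℝ≥0∞} (hκ : κ ≠ ∞) (hgκ : ∀ u, g u ≤ κ) (k : Fin d → ℤ) :
    (∀ᵐ ω ∂P, ∫⁻ u in cell k, g u ∂(pts X ω) ≠ ∞) ∧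
    Integrable (fun ω => cellSum X g k ω ^ m) P ∧
    ∫ ω, cellSum X g k ω ^ m ∂P ≤
      (κ ^ m * ((m : ℝ≥0∞) ^ m * (1 + ENNReal.ofReal K))).toReal := by
  have hmeas : Measurable fun ω => ∫⁻ u in cell k, g u ∂(pts X ω) :=
    (measurable_setLIntegral_pts X (measurableSet_cell k) hg).mono
      (sigmaOf_le hX (measurableSet_cell k)) le_rfl
  have hb := lintegral_setLIntegral_pts_pow_le hX hr hK (measurableSet_cell k)
    (isBounded_cell k) (volume_cell k).le hκ hgκ
  have hfin : κ ^ m * ((m : ℝ≥0∞) ^ m * (1 + ENNReal.ofReal K)) ≠ ∞ := by finiteness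
  have hlt : ∫⁻ ω, (∫⁻ u in cell k, g u ∂(pts X ω)) ^ m ∂P ≠ ∞ := ne_top_of_le_ne_top hfin hb
  refine ⟨?_, ?_, ?_⟩
  · filter_upwards [ae_lt_top (hmeas.pow_const m) hlt] with ω hω
    rintro h
    rw [h, ENNReal.top_pow hm] at hω
    exact lt_irrefl _ hω
  · simp_rw [cellSum, ← ENNReal.toReal_pow]
    exact integrable_toReal_of_lintegral_ne_top (hmeas.pow_const m).aemeasurable hlt
  · simp_rw [cellSum, ← ENNReal.toReal_pow]
    rw [integral_toReal (hmeas.pow_const m).aemeasurable (ae_lt_top (hmeas.pow_const m) hlt)]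
    exact ENNReal.toReal_mono hfin hb

/-- Covariances between unit cubes decay polynomially with exponent larger than `d`. -/
lemma exists_cov_cellSum_le {P : Measure Ω} [IsProbabilityMeasure P] {X : Ω → Set (Sp d)}
    (hX : IsPointProcess P X) {t : ℕ} (ht : 1 ≤ t) {r : (Fin (2 + t) → Sp d) → ℝ}
    (hr : IsProductDensity P X (2 + t) r) {K : ℝ} (hK : ∀ x, r x ≤ K)
    (hmix : ∃ t' : ℝ, (d : ℝ) * (2 + t) / t < t' ∧
      (fun q : ℝ => mixCoef P X 2 ⊤ q) =O[atTop] fun q : ℝ => q ^ (-t'))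
    {κ : ℝ≥0∞} (hκ : κ ≠ ∞) :
    ∃ τ : ℝ, d < τ ∧ ∃ C : ℝ, 0 ≤ C ∧ ∀ g : Sp d → ℝ≥0∞, Measurable g → (∀ u, g u ≤ κ) →
      ∀ k l, ProbabilityTheory.covariance (cellSum X g k) (cellSum X g l) P ≤
        C * latticeRate τ (k - l) := by
  obtain ⟨t', ht', hO⟩ := hmix
  obtain ⟨c, hc⟩ := hO.bound
  obtain ⟨q₀, hq₀⟩ := eventually_atTop.1 hc
  have ht0 : (0 : ℝ) < t := by exact_mod_cast ht
  have ht'0 : 0 < t' := lt_of_le_of_lt (by positivity) ht'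
  set K₀ : ℝ := (κ ^ (2 + t) * (((2 + t : ℕ) : ℝ≥0∞) ^ (2 + t) * (1 + ENNReal.ofReal K))).toReal
    with hK₀
  have hK₀0 : 0 ≤ K₀ := ENNReal.toReal_nonneg
  set τ : ℝ := t' * t / (2 + t) with hτ
  have hτd : (d : ℝ) < τ := by
    rw [hτ, lt_div_iff₀ (by positivity)]
    rw [div_lt_iff₀ ht0] at ht'
    linarith
  have hτ0 : 0 < τ := by positivity
  set Q : ℝ := max q₀ 1 with hQ
  have hQ1 : 1 ≤ Q := le_max_right _ _
  set C₁ : ℝ := 2 * (1 + K₀) with hC₁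
  set C₂ : ℝ := (|c| + 4 * K₀) * 2 ^ τ
  have hC₂ : 0 ≤ C₂ := by positivity
  have hC₁0 : 0 ≤ C₁ := by positivity
  refine ⟨τ, hτd, C₁ + C₁ * (2 * Q) ^ τ + C₂, by positivity, fun g hg hgκ k l => ?_⟩
  have hpow := fun k => integrable_cellSum_pow hX (by omega : 2 + t ≠ 0) hr hK hg hκ hgκ k
  have hmeas : ∀ k, Measurable (cellSum X g k) := fun k =>
    (measurable_cellSum X hg k).mono (sigmaOf_le hX (measurableSet_cell k)) le_rfl
  have hnn := cellSum_nonneg X g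
  have hint : ∀ k, ∀ i ≤ 2 + t, Integrable (fun ω => cellSum X g k ω ^ i) P := by
    intro k i hi
    refine ((integrable_const (1 : ℝ)).add (hpow k).2.1).mono'
      ((hmeas k).pow_const i).aestronglyMeasurable (ae_of_all _ fun ω => ?_)
    rw [Real.norm_of_nonneg (pow_nonneg (hnn k ω) i)]
    exact pow_le_one_add_pow (hnn k ω) hi
  have hint1 : ∀ k, Integrable (cellSum X g k) P := fun k => by
    simpa using hint k 1 (by omega)
  have hL2 : ∀ k, MemLp (cellSum X g k) 2 P := fun k =>
    (memLp_two_iff_integrable_sq (hmeas k).aestronglyMeasurable).2 (hint k 2 (by omega))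
  have hcov : ProbabilityTheory.covariance (cellSum X g k) (cellSum X g l) P =
      ∫ ω, cellSum X g k ω * cellSum X g l ω ∂P -
        (∫ ω, cellSum X g k ω ∂P) * ∫ ω, cellSum X g l ω ∂P :=
    ProbabilityTheory.covariance_eq_sub (hL2 k) (hL2 l)
  have hnear : ProbabilityTheory.covariance (cellSum X g k) (cellSum X g l) P ≤ C₁ := by
    rw [hcov]
    have h1 : 0 ≤ (∫ ω, cellSum X g k ω ∂P) * ∫ ω, cellSum X g l ω ∂P :=
      mul_nonneg (integral_nonneg (hnn k)) (integral_nonneg (hnn l))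
    have hs : Integrable (fun ω => cellSum X g k ω ^ (2 + t) + cellSum X g l ω ^ (2 + t)) P :=
      (hpow k).2.1.add (hpow l).2.1
    have h2 : ∫ ω, cellSum X g k ω * cellSum X g l ω ∂P ≤
        ∫ ω, (2 + (cellSum X g k ω ^ (2 + t) + cellSum X g l ω ^ (2 + t))) ∂P := by
      refine integral_mono_of_nonneg (ae_of_all _ fun ω => mul_nonneg (hnn k ω) (hnn l ω))
        ((integrable_const _).add hs) (ae_of_all _ fun ω => ?_)
      have e1 := pow_le_one_add_pow (hnn k ω) (i := 2) (m := 2 + t) (by omega)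
      have e2 := pow_le_one_add_pow (hnn l ω) (i := 2) (m := 2 + t) (by omega)
      have e3 := two_mul_le_add_sq (cellSum X g k ω) (cellSum X g l ω)
      have e4 := hnn k ω
      have e5 := hnn l ω
      have e6 := mul_nonneg e4 e5
      simp only
      linarith
    rw [integral_add (integrable_const _) hs, integral_add (hpow k).2.1 (hpow l).2.1] at h2
    have h3 := (hpow k).2.2
    have h4 := (hpow l).2.2
    simp only [integral_const, probReal_univ, smul_eq_mul, one_mul] at h2
    rw [hC₁]
    linarith
  have hrate := latticeRate_nonneg τ (k - l)
  by_cases hkl : k - l = 0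
  · have : latticeRate τ (k - l) = 1 := by simp [latticeRate, hkl]
    rw [this, mul_one]
    have : 0 ≤ C₁ * (2 * Q) ^ τ := by positivity
    linarith
  have hrate' : latticeRate τ (k - l) = ‖k - l‖ ^ (-τ) := by simp [latticeRate, hkl]
  set R : ℝ := ‖k - l‖ with hR
  have hR0 : 0 < R := norm_pos_iff.2 hkl
  rcases lt_or_ge R (2 * Q) with hfar | hfar
  · have h1 : 1 ≤ (2 * Q) ^ τ * R ^ (-τ) := by
      rw [Real.rpow_neg hR0.le, ← div_eq_mul_inv, one_le_div (by positivity)]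
      exact Real.rpow_le_rpow hR0.le hfar.le hτ0.le
    have h2 : C₁ * 1 ≤ C₁ * ((2 * Q) ^ τ * R ^ (-τ)) := by gcongr
    have h3 : 0 ≤ (C₁ + C₂) * latticeRate τ (k - l) := by positivity
    calc _ ≤ C₁ * ((2 * Q) ^ τ * R ^ (-τ)) := by linarith
      _ ≤ C₁ * ((2 * Q) ^ τ * R ^ (-τ)) + (C₁ + C₂) * latticeRate τ (k - l) := by linarith
      _ = _ := by rw [hrate']; ring
  · set q : ℝ := R / 2 with hq
    have hqQ : Q ≤ q := by rw [hq]; linarith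
    have hq0 : 0 < q := by positivity
    have hmixq : mixCoef P X 2 ⊤ q ≤ |c| * q ^ (-t') := by
      have := hq₀ q ((le_max_left _ _).trans hqQ)
      rw [Real.norm_eq_abs, Real.norm_of_nonneg (by positivity : (0 : ℝ) ≤ q ^ (-t'))] at this
      refine (le_abs_self _).trans (this.trans ?_)
      gcongr
      exact le_abs_self c
    set M : ℝ := q ^ (t' / (2 + t)) with hM
    have hM0 : 0 < M := by positivity
    have hfac := integral_mul_sub_le_of_mixing (P := P) (sigmaOf_le hX (measurableSet_cell k))
      (sigmaOf_le hX (measurableSet_cell l)) (a := |c| * q ^ (-t')) (M := M) (K := K₀) (t := t)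
      (fun A B hA hB => (abs_sub_le_mixCoef P X 2 ⊤ (q := q) (measurableSet_cell k)
        (measurableSet_cell l) (by rw [volume_cell]; norm_num) (by simp) (fun x hx y hy => by
          have := norm_sub_sub_one_le_dist hx hy
          have : R - 1 ≤ dist x y := this
          linarith) hA hB).trans hmixq) hM0
      (measurable_cellSum X hg k) (hnn k) (measurable_cellSum X hg l) (hnn l)
      (hint1 k) (hint1 l) (hpow k).2.1 (hpow l).2.1 (hpow k).2.2 (hpow l).2.2
    have e1 : M ^ 2 * q ^ (-t') = q ^ (-τ) := by
      rw [hM, ← Real.rpow_natCast, ← Real.rpow_mul hq0.le, ← Real.rpow_add hq0]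
      congr 1
      rw [hτ]
      push_cast
      field_simp
      ring
    have e2 : (M ^ t)⁻¹ = q ^ (-τ) := by
      rw [hM, ← Real.rpow_natCast, ← Real.rpow_mul hq0.le, ← Real.rpow_neg hq0.le]
      congr 1
      rw [hτ]
      field_simp
    have e3 : q ^ (-τ) = 2 ^ τ * R ^ (-τ) := by
      rw [hq, Real.div_rpow hR0.le (by norm_num), Real.rpow_neg (by norm_num : (0 : ℝ) ≤ 2),
        div_inv_eq_mul, mul_comm]
    have e4 : M ^ 2 * (|c| * q ^ (-t')) + 4 * K₀ * (M ^ t)⁻¹ = C₂ * latticeRate τ (k - l) := by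
      rw [hrate', e2]
      calc _ = |c| * (M ^ 2 * q ^ (-t')) + 4 * K₀ * q ^ (-τ) := by ring
        _ = (|c| + 4 * K₀) * (2 ^ τ * R ^ (-τ)) := by rw [e1, e3]; ring
        _ = _ := by ring
    rw [e4, ← hcov] at hfac
    have : 0 ≤ (C₁ + C₁ * (2 * Q) ^ τ) * latticeRate τ (k - l) := by positivity
    calc _ ≤ C₂ * latticeRate τ (k - l) := hfac
      _ ≤ (C₁ + C₁ * (2 * Q) ^ τ) * latticeRate τ (k - l) + C₂ * latticeRate τ (k - l) := by
        linarith
      _ = _ := by ring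

/-- The variance of a linear statistic of the points in a set grows at most like the volume of
the surrounding ball. -/
lemma exists_meas_abs_sub_le {P : Measure Ω} [IsProbabilityMeasure P] {X : Ω → Set (Sp d)}
    (hX : IsPointProcess P X) {t : ℕ} (ht : 1 ≤ t) {r : (Fin (2 + t) → Sp d) → ℝ}
    (hr : IsProductDensity P X (2 + t) r) {K : ℝ} (hK : ∀ x, r x ≤ K)
    (hmix : ∃ t' : ℝ, (d : ℝ) * (2 + t) / t < t' ∧
      (fun q : ℝ => mixCoef P X 2 ⊤ q) =O[atTop] fun q : ℝ => q ^ (-t'))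
    {κ : ℝ≥0∞} (hκ : κ ≠ ∞) :
    ∃ C : ℝ, 0 ≤ C ∧ ∀ f : Sp d → ℝ≥0∞, Measurable f → (∀ u, f u ≤ κ) →
      ∀ m : ℕ, 1 ≤ m → ∀ D : Set (Sp d), MeasurableSet D → (∀ u ∈ D, ‖u‖ ≤ m) → ∀ c : ℝ, 0 < c →
        P {ω | c ≤ |(∫⁻ u in D, f u ∂(pts X ω)).toReal -
          (∫⁻ ω, ∫⁻ u in D, f u ∂(pts X ω) ∂P).toReal|} ≤
          ENNReal.ofReal (C * (m : ℝ) ^ d / c ^ 2) := by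
  obtain ⟨τ, hτ, C, hC, hcov⟩ := exists_cov_cellSum_le hX ht hr hK hmix hκ
  have hG : 0 ≤ ∑' h, latticeRate (d := d) τ h := tsum_nonneg (latticeRate_nonneg τ)
  refine ⟨C * (3 ^ d * ∑' h, latticeRate (d := d) τ h), by positivity,
    fun f hf hfκ m hm D hD hDm c hc => ?_⟩
  set g : Sp d → ℝ≥0∞ := D.indicator f with hg
  have hgm : Measurable g := hf.indicator hD
  have hgκ : ∀ u, g u ≤ κ := fun u => (indicator_le_self D f u).trans (hfκ u)
  set I : Finset (Fin d → ℤ) := Fintype.piFinset fun _ : Fin d => Finset.Icc (-m : ℤ) m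
  have hpow := fun k => integrable_cellSum_pow hX (by omega : 2 + t ≠ 0) hr hK hgm hκ hgκ k
  have hmeas : ∀ k, Measurable (cellSum X g k) := fun k =>
    (measurable_cellSum X hgm k).mono (sigmaOf_le hX (measurableSet_cell k)) le_rfl
  have hL2 : ∀ k, MemLp (cellSum X g k) 2 P := fun k => by
    refine (memLp_two_iff_integrable_sq (hmeas k).aestronglyMeasurable).2 ?_
    refine ((integrable_const (1 : ℝ)).add (hpow k).2.1).mono'
      ((hmeas k).pow_const 2).aestronglyMeasurable (ae_of_all _ fun ω => ?_)
    rw [Real.norm_of_nonneg (by positivity)]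
    exact pow_le_one_add_pow (cellSum_nonneg X g k ω) (by omega)
  have hdecomp : ∀ ω, ∫⁻ u in D, f u ∂(pts X ω) =
      ∑ k ∈ I, ∫⁻ u in cell k, g u ∂(pts X ω) := fun ω => by
    rw [← lintegral_biUnion_finset (fun k _ l _ hkl => pairwise_disjoint_cell hkl)
      (fun k _ => measurableSet_cell k), hg, setLIntegral_indicator hD,
      inter_eq_left.2 (subset_biUnion_cell hDm)]
  set Y : Ω → ℝ := fun ω => ∑ k ∈ I, cellSum X g k ω with hY
  have hYL2 : MemLp Y 2 P := memLp_finsetSum I fun k _ => hL2 k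
  have hYeq : ∀ᵐ ω ∂P, (∫⁻ u in D, f u ∂(pts X ω)).toReal = Y ω ∧
      ∫⁻ u in D, f u ∂(pts X ω) ≠ ∞ := by
    have : ∀ᵐ ω ∂P, ∀ k ∈ I, ∫⁻ u in cell k, g u ∂(pts X ω) ≠ ∞ :=
      (Finset.eventually_all I).2 fun k _ => (hpow k).1
    filter_upwards [this] with ω hω
    rw [hdecomp, ENNReal.toReal_sum hω]
    exact ⟨rfl, ENNReal.sum_ne_top.2 hω⟩
  have hmeasD : Measurable fun ω => ∫⁻ u in D, f u ∂(pts X ω) :=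
    (measurable_setLIntegral_pts X hD hf).mono (sigmaOf_le hX hD) le_rfl
  have hmean : (∫⁻ ω, ∫⁻ u in D, f u ∂(pts X ω) ∂P).toReal = ∫ ω, Y ω ∂P := by
    rw [← integral_toReal hmeasD.aemeasurable
      (hYeq.mono fun ω hω => hω.2.lt_top)]
    exact integral_congr_ae (hYeq.mono fun ω hω => hω.1)
  have hvar : ProbabilityTheory.variance Y P ≤
      C * (3 ^ d * ∑' h, latticeRate (d := d) τ h) * (m : ℝ) ^ d := by
    rw [← ProbabilityTheory.covariance_self hYL2.aestronglyMeasurable.aemeasurable, hY,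
      ProbabilityTheory.covariance_fun_sum_fun_sum' (fun k _ => hL2 k) (fun k _ => hL2 k)]
    calc _ ≤ ∑ k ∈ I, ∑ l ∈ I, C * latticeRate τ (k - l) :=
          Finset.sum_le_sum fun k _ => Finset.sum_le_sum fun l _ => hcov g hgm hgκ k l
      _ = C * ∑ k ∈ I, ∑ l ∈ I, latticeRate τ (k - l) := by simp_rw [Finset.mul_sum]
      _ ≤ C * (I.card * ∑' h, latticeRate (d := d) τ h) := by
          gcongr; exact sum_sum_latticeRate_le hτ I
      _ ≤ C * (3 ^ d * (m : ℝ) ^ d * ∑' h, latticeRate (d := d) τ h) := by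
          gcongr; exact card_piFinset_Icc_le hm
      _ = _ := by ring
  calc P {ω | c ≤ |(∫⁻ u in D, f u ∂(pts X ω)).toReal -
          (∫⁻ ω, ∫⁻ u in D, f u ∂(pts X ω) ∂P).toReal|}
      ≤ P {ω | c ≤ |Y ω - ∫ ω, Y ω ∂P|} := by
        refine measure_mono_ae (hYeq.mono fun ω hω => ?_)
        rw [hmean]
        intro h
        change c ≤ |Y ω - ∫ ω, Y ω ∂P|
        rw [← hω.1]
        exact h
    _ ≤ ENNReal.ofReal (ProbabilityTheory.variance Y P / c ^ 2) :=
        ProbabilityTheory.meas_ge_le_variance_div_sq hYL2 hc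
    _ ≤ _ := by gcongr

end Variance

section Argmax

/-- Measurable selection of a maximizer, over a compact set, of a linear functional minus a lower
semicontinuous function. -/
lemma exists_measurable_argmax {V : Type*} [NormedAddCommGroup V] [InnerProductSpace ℝ V]
    [MeasurableSpace V] [BorelSpace V] {K : Set V} (hK : IsCompact K) (hne : K.Nonempty)
    {h : V → ℝ} (hh : LowerSemicontinuous h) :
    ∃ g : V → V, Measurable g ∧ ∀ S, g S ∈ K ∧
      ∀ γ ∈ K, inner ℝ γ S - h γ ≤ inner ℝ (g S) S - h (g S) := by
  have : CompactSpace K := isCompact_iff_compactSpace.1 hK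
  have : Nonempty K := hne.to_subtype
  have : CompactSpace cantorSet := isCompact_iff_compactSpace.1 isCompact_cantorSet
  obtain ⟨φ₀, hφ₀, hφ₀s⟩ := exists_nat_bool_continuous_surjective_of_compact K
  set φ : cantorSet → V := fun c => φ₀ (cantorSetHomeomorphNatToBool c) with hφ
  have hφc : Continuous φ :=
    continuous_subtype_val.comp (hφ₀.comp cantorSetHomeomorphNatToBool.continuous)
  have hφK : ∀ c, φ c ∈ K := fun c => Subtype.coe_prop _
  have hφs : ∀ γ ∈ K, ∃ c, φ c = γ := fun γ hγ => by
    obtain ⟨b, hb⟩ := hφ₀s ⟨γ, hγ⟩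
    exact ⟨cantorSetHomeomorphNatToBool.symm b, by simp [hφ, hb]⟩
  set Z : Set (V × cantorSet) :=
    {x | ∀ γ ∈ K, inner ℝ γ x.1 - h γ ≤ inner ℝ (φ x.2) x.1 - h (φ x.2)} with hZ
  have hZc : IsClosed Z := by
    have : Z = ⋂ γ ∈ K, {x : V × cantorSet |
        h (φ x.2) + (inner ℝ γ x.1 - inner ℝ (φ x.2) x.1) ≤ h γ} := by
      ext x
      simp only [hZ, mem_ofPred_eq, mem_iInter]
      refine forall₂_congr fun γ _ => ?_
      constructor <;> intro h <;> linarith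
    rw [this]
    refine isClosed_biInter fun γ _ => ?_
    have h1 : LowerSemicontinuous fun x : V × cantorSet => h (φ x.2) :=
      hh.comp (hφc.comp continuous_snd)
    have h2 : Continuous fun x : V × cantorSet => inner ℝ γ x.1 - inner ℝ (φ x.2) x.1 := by
      fun_prop
    exact (h1.add h2.lowerSemicontinuous).isClosed_preimage (h γ)
  have hleast : ∀ S, ∃ c, IsLeast {c | (S, c) ∈ Z} c := fun S => by
    refine IsCompact.exists_isLeast ?_ ?_
    · exact (hZc.preimage (by fun_prop : Continuous fun c : cantorSet => (S, c))).isCompact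
    · have hlsc : LowerSemicontinuousOn (fun γ => h γ - inner ℝ γ S) K := by
        have h2 : Continuous fun γ : V => -inner ℝ γ S := by fun_prop
        have := (hh.add h2.lowerSemicontinuous).lowerSemicontinuousOn K
        simpa [sub_eq_add_neg] using this
      obtain ⟨γ₀, hγ₀, hmin⟩ := hlsc.exists_isMinOn hne hK
      obtain ⟨c, hc⟩ := hφs γ₀ hγ₀
      refine ⟨c, fun γ hγ => ?_⟩
      have := isMinOn_iff.1 hmin γ hγ
      simp only [hc]
      linarith
  choose c hc using hleast
  have hcm : Measurable c := by
    have : Measurable fun S => (c S : ℝ) := by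
      refine measurable_of_Iic fun r => ?_
      have : (fun S => (c S : ℝ)) ⁻¹' Iic r =
          Prod.fst '' (Z ∩ {x : V × cantorSet | (x.2 : ℝ) ≤ r}) := by
        ext S
        constructor
        · intro h
          exact ⟨(S, c S), ⟨(hc S).1, h⟩, rfl⟩
        · rintro ⟨⟨S', c'⟩, ⟨h1, h2⟩, rfl⟩
          exact (Subtype.coe_le_coe.2 ((hc S').2 h1)).trans h2
      rw [this]
      refine (isClosedMap_fst_of_compactSpace _ (hZc.inter ?_)).measurableSet
      exact isClosed_le (by fun_prop) continuous_const
    exact this.subtype_mk (h := fun S => (c S).2)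
  exact ⟨fun S => φ (c S), hφc.measurable.comp hcm, fun S => ⟨hφK _, (hc S).1⟩⟩

end Argmax

section Penalty

lemma IsPenalty.lowerSemicontinuous_comp_abs {f : ℝ → ℝ} (hf : IsPenalty f) :
    LowerSemicontinuous fun x : ℝ => f |x| := by
  intro x
  rcases eq_or_ne x 0 with rfl | hx
  · intro y hy
    simp only [abs_zero, hf.zero] at hy
    exact Eventually.of_forall fun x => hy.trans_le (hf.nonneg _ (abs_nonneg x))
  · have h1 : ContinuousAt f |x| :=
      (hf.contDiff.continuousOn.continuousAt (Ioi_mem_nhds (abs_pos.2 hx)))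
    exact (ContinuousAt.comp (f := fun x : ℝ => |x|) h1 continuous_abs.continuousAt
      ).lowerSemicontinuousAt

lemma le_of_abs_iteratedDeriv_three_le {f : ℝ → ℝ} {x₀ r M x : ℝ} (hx₀ : 0 < x₀)
    (hf : ContDiffOn ℝ 3 f (Metric.ball x₀ r ∩ Ioi 0))
    (hM : ∀ θ ∈ Metric.ball x₀ r ∩ Ioi 0, |iteratedDeriv 3 f θ| ≤ M)
    (hxr : |x - x₀| < r) (hx : 0 < x) :
    f x₀ - |deriv f x₀| * |x - x₀| -
      (|iteratedDeriv 2 f x₀| + M * |x - x₀|) * |x - x₀| ^ 2 ≤ f x := by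
  set U : Set ℝ := Metric.ball x₀ r ∩ Ioi 0
  have hU : IsOpen U := Metric.isOpen_ball.inter isOpen_Ioi
  have hr : 0 < r := (abs_nonneg _).trans_lt hxr
  have hx₀U : x₀ ∈ U := ⟨Metric.mem_ball_self hr, hx₀⟩
  have hM0 : 0 ≤ M := (abs_nonneg _).trans (hM x₀ hx₀U)
  have h1 : ContDiffOn ℝ 2 (deriv f) U := hf.deriv_of_isOpen hU (by norm_num)
  have h2 : ContDiffOn ℝ 1 (deriv (deriv f)) U := h1.deriv_of_isOpen hU (by norm_num)
  have e2 : iteratedDeriv 2 f = deriv (deriv f) := by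
    rw [iteratedDeriv_succ, iteratedDeriv_one]
  have e3 : iteratedDeriv 3 f = deriv (deriv (deriv f)) := by
    rw [iteratedDeriv_succ, e2]
  rw [e2]
  rw [e3] at hM
  set η : ℝ := |x - x₀| with hη
  have hη0 : 0 ≤ η := abs_nonneg _
  set s : Set ℝ := U ∩ Metric.closedBall x₀ η
  have hs : Convex ℝ s :=
    ((convex_ball x₀ r).inter (convex_Ioi 0)).inter (convex_closedBall x₀ η)
  have hsU : s ⊆ U := inter_subset_left
  have hx₀s : x₀ ∈ s := ⟨hx₀U, Metric.mem_closedBall_self hη0⟩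
  have hxs : x ∈ s := ⟨⟨by simpa [Real.dist_eq] using hxr, hx⟩, by simp [Real.dist_eq, hη]⟩
  have hdist : ∀ y ∈ s, ‖y - x₀‖ ≤ η := fun y hy => by
    simpa [Real.dist_eq] using hy.2
  have diff : ∀ {g : ℝ → ℝ} {n : ℕ}, n ≠ 0 → ContDiffOn ℝ n g U → ∀ y ∈ s, DifferentiableAt ℝ g y :=
    fun hn hg y hy => (hg.contDiffAt (hU.mem_nhds (hsU hy))).differentiableAt (by exact_mod_cast hn)
  set B : ℝ := |deriv (deriv f) x₀| + M * η
  have b2 : ∀ y ∈ s, ‖deriv (deriv f) y‖ ≤ B := fun y hy => by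
    have := hs.norm_image_sub_le_of_norm_deriv_le (diff one_ne_zero h2)
      (fun z hz => hM z (hsU hz)) hx₀s hy
    have h3 : M * ‖y - x₀‖ ≤ M * η := by gcongr; exact hdist y hy
    have h4 := norm_sub_norm_le (deriv (deriv f) y) (deriv (deriv f) x₀)
    have h5 : ‖deriv (deriv f) x₀‖ = |deriv (deriv f) x₀| := rfl
    linarith
  have hB : 0 ≤ B := by positivity
  have b1 : ∀ y ∈ s, ‖deriv f y - deriv f x₀‖ ≤ B * η := fun y hy => by
    have := hs.norm_image_sub_le_of_norm_deriv_le (diff two_ne_zero h1) b2 hx₀s hy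
    refine this.trans ?_
    gcongr; exact hdist y hy
  have df := diff (n := 3) (by norm_num) hf
  have hder : ∀ y ∈ s, HasDerivAt (fun y => f y - deriv f x₀ * y) (deriv f y - deriv f x₀) y :=
    fun y hy => by
      have h := (df y hy).hasDerivAt.sub ((hasDerivAt_id y).const_mul (deriv f x₀))
      rw [mul_one] at h
      exact h
  have b0 := hs.norm_image_sub_le_of_norm_deriv_le (f := fun y => f y - deriv f x₀ * y)
    (C := B * η) (fun y hy => (hder y hy).differentiableAt)
    (fun y hy => by rw [(hder y hy).deriv]; exact b1 y hy) hx₀s hxs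
  have b0' := (abs_le.1 b0).1
  have h6 : -(|deriv f x₀| * η) ≤ deriv f x₀ * (x - x₀) := by
    rw [hη, ← abs_mul]; exact neg_abs_le _
  have h7 : B * η * ‖x - x₀‖ = B * η ^ 2 := by rw [Real.norm_eq_abs, ← hη]; ring
  rw [h7] at b0'
  linarith

/-- Lower bound for the increment of the penalty around the true parameter. -/
lemma le_sum_penalty_sub {p : ℕ} {f : Fin p → ℝ → ℝ} (hf : ∀ j, IsPenalty (f j)) {β₀ : Sp p}
    {s : ℕ} (hs : ∀ j : Fin p, β₀ j ≠ 0 ↔ (j : ℕ) < s) {r : Fin p → ℝ} {M a c : ℝ}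
    (hM0 : 0 ≤ M) (ha0 : 0 ≤ a) (hc0 : 0 ≤ c)
    (hsm : ∀ j : Fin p, (j : ℕ) < s →
      ContDiffOn ℝ 3 (f j) (Metric.ball |β₀ j| (r j) ∩ Ioi 0) ∧
      ∀ θ ∈ Metric.ball |β₀ j| (r j) ∩ Ioi 0, |iteratedDeriv 3 (f j) θ| ≤ M)
    (ha : ∀ j : Fin p, (j : ℕ) < s → |deriv (f j) (|β₀ j|)| ≤ a)
    (hc : ∀ j : Fin p, (j : ℕ) < s → |iteratedDeriv 2 (f j) (|β₀ j|)| ≤ c) {δ : Sp p}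
    (hr : ∀ j : Fin p, (j : ℕ) < s → ‖δ‖ < r j)
    (hδ : ∀ j : Fin p, (j : ℕ) < s → ‖δ‖ < |β₀ j|) :
    -(p * (a * ‖δ‖ + (c + M * ‖δ‖) * ‖δ‖ ^ 2)) ≤ ∑ j, (f j |(β₀ + δ) j| - f j |β₀ j|) := by
  have key : ∀ j : Fin p, -(a * ‖δ‖ + (c + M * ‖δ‖) * ‖δ‖ ^ 2) ≤
      f j |(β₀ + δ) j| - f j |β₀ j| := by
    intro j
    by_cases hj : (j : ℕ) < s
    · set η : ℝ := |(|(β₀ + δ) j| - |β₀ j|)| with hη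
      have hηδ : η ≤ ‖δ‖ := by
        have h1 := abs_abs_sub_abs_le ((β₀ + δ) j) (β₀ j)
        have h2 : |δ j| ≤ ‖δ‖ := PiLp.norm_apply_le δ j
        simp only [PiLp.add_apply, add_sub_cancel_left] at h1
        exact h1.trans h2
      have hη0 : 0 ≤ η := abs_nonneg _
      have hpos : 0 < |(β₀ + δ) j| := by
        have h1 := (abs_le.1 (hη ▸ hηδ)).1
        have h2 := hδ j hj
        linarith
      have h := le_of_abs_iteratedDeriv_three_le (abs_pos.2 ((hs j).2 hj)) (hsm j hj).1
        (hsm j hj).2 (hηδ.trans_lt (hr j hj)) hpos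
      rw [← hη] at h
      have h3 : |deriv (f j) (|β₀ j|)| * η ≤ a * ‖δ‖ :=
        mul_le_mul (ha j hj) hηδ hη0 ha0
      have h4 : (|iteratedDeriv 2 (f j) (|β₀ j|)| + M * η) * η ^ 2 ≤ (c + M * ‖δ‖) * ‖δ‖ ^ 2 := by
        have := hc j hj
        gcongr
      linarith
    · have h0 : β₀ j = 0 := by
        by_contra h
        exact hj ((hs j).1 h)
      have h1 : 0 ≤ f j |(β₀ + δ) j| := (hf j).nonneg _ (abs_nonneg _)
      rw [h0, abs_zero, (hf j).zero]
      have : 0 ≤ a * ‖δ‖ + (c + M * ‖δ‖) * ‖δ‖ ^ 2 := by positivity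
      linarith
  calc _ = ∑ _j : Fin p, -(a * ‖δ‖ + (c + M * ‖δ‖) * ‖δ‖ ^ 2) := by
          rw [Finset.sum_const, Finset.card_univ, Fintype.card_fin, nsmul_eq_mul, mul_neg]
    _ ≤ _ := Finset.sum_le_sum fun j _ => key j

end Penalty

section Likelihood

variable {d p : ℕ}

lemma exists_pos_mul_norm_sq_le_of_posDef {A : Matrix (Fin p) (Fin p) ℝ} (hA : A.PosDef) :
    ∃ κ : ℝ, 0 < κ ∧ ∀ x : Sp p, κ * ‖x‖ ^ 2 ≤ dotProduct x.ofLp (A.mulVec x.ofLp) := by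
  have hcont : Continuous fun x : Sp p => dotProduct x.ofLp (A.mulVec x.ofLp) := by fun_prop
  have hpos : ∀ x : Sp p, x ≠ 0 → 0 < dotProduct x.ofLp (A.mulVec x.ofLp) := fun x hx => by
    have := hA.dotProduct_mulVec_pos (x := x.ofLp) (by simpa using hx)
    simpa using this
  rcases (Metric.sphere (0 : Sp p) 1).eq_empty_or_nonempty with h | h
  · have h0 : ∀ x : Sp p, x = 0 := fun x => by
      by_contra hx
      have : (‖x‖⁻¹ • x) ∈ Metric.sphere (0 : Sp p) 1 := by
        simp [norm_smul, hx]
      rw [h] at this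
      exact this
    refine ⟨1, one_pos, fun x => ?_⟩
    rw [h0 x]; simp
  · obtain ⟨x₀, hx₀, hmin⟩ := (isCompact_sphere (0 : Sp p) 1).exists_isMinOn h hcont.continuousOn
    have hx₀0 : x₀ ≠ 0 := by
      rintro rfl; simp at hx₀
    refine ⟨_, hpos x₀ hx₀0, fun x => ?_⟩
    rcases eq_or_ne x 0 with rfl | hx
    · simp
    · have h1 := isMinOn_iff.1 hmin (‖x‖⁻¹ • x) (by simp [norm_smul, hx])
      simp only [WithLp.ofLp_smul, Matrix.mulVec_smul, smul_dotProduct, dotProduct_smul,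
        smul_eq_mul] at h1
      have hn : 0 < ‖x‖ := norm_pos_iff.2 hx
      calc _ ≤ ‖x‖⁻¹ * (‖x‖⁻¹ * dotProduct x.ofLp (A.mulVec x.ofLp)) * ‖x‖ ^ 2 := by gcongr
        _ = _ := by field_simp

lemma mul_norm_sq_le_of_posSemidef {A B : Matrix (Fin p) (Fin p) ℝ} {v κ : ℝ} (hv : 0 < v)
    (hκ : ∀ x : Sp p, κ * ‖x‖ ^ 2 ≤ dotProduct x.ofLp (B.mulVec x.ofLp))
    (h : (v⁻¹ • A - B).PosSemidef) (x : Sp p) :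
    v * (κ * ‖x‖ ^ 2) ≤ dotProduct x.ofLp (A.mulVec x.ofLp) := by
  have h1 := h.dotProduct_mulVec_nonneg x.ofLp
  simp only [star_trivial, Matrix.sub_mulVec, Matrix.smul_mulVec, dotProduct_sub,
    dotProduct_smul, smul_eq_mul] at h1
  have h2 := hκ x
  have h3 : κ * ‖x‖ ^ 2 ≤ v⁻¹ * dotProduct x.ofLp (A.mulVec x.ofLp) := by linarith
  calc _ ≤ v * (v⁻¹ * dotProduct x.ofLp (A.mulVec x.ofLp)) := by gcongr
    _ = _ := by field_simp

lemma abs_exp_sub_quadratic_le {x : ℝ} (hx : |x| ≤ 1) :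
    |Real.exp x - (1 + x + x ^ 2 / 2)| ≤ |x| ^ 3 := by
  have h := Real.exp_bound hx (n := 3) (by norm_num)
  simp only [Finset.sum_range_succ, Finset.sum_range_zero, Nat.factorial] at h
  norm_num at h
  have : 0 ≤ |x| ^ 3 := by positivity
  linarith

variable {z : Sp d → Sp p} {w : Sp d → ℝ} {D : Set (Sp d)} {Kz Kw : ℝ}

lemma measurable_rho (hz : Measurable z) (β : Sp p) : Measurable (rho z β) := by
  unfold rho; fun_prop

lemma abs_inner_le (hKz : ∀ u, ‖z u‖ ≤ Kz) (δ : Sp p) (u : Sp d) :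
    |inner ℝ δ (z u)| ≤ ‖δ‖ * Kz :=
  (abs_real_inner_le_norm δ (z u)).trans (by gcongr; exact hKz u)

lemma rho_pos (β : Sp p) (u : Sp d) : 0 < rho z β u := Real.exp_pos _

lemma rho_le (hKz : ∀ u, ‖z u‖ ≤ Kz) (β : Sp p) (u : Sp d) :
    rho z β u ≤ Real.exp (‖β‖ * Kz) :=
  Real.exp_le_exp.2 ((le_abs_self _).trans (abs_inner_le hKz β u))

lemma integrableOn_of_abs_le {f : Sp d → ℝ} (hf : Measurable f) (hD : volume D ≠ ∞) {C : ℝ}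
    (hC : ∀ u, |f u| ≤ C) : IntegrableOn f D :=
  Measure.integrableOn_of_bounded (M := C) hD hf.aestronglyMeasurable (ae_of_all _ hC)

/-- The mean of the linear statistic `∑ w z`. -/
def meanStat (z : Sp d → Sp p) (w : Sp d → ℝ) (β : Sp p) (D : Set (Sp d)) : Sp p :=
  WithLp.toLp 2 fun j => ∫ u in D, w u * z u j * rho z β u

lemma abs_apply_le (hKz : ∀ u, ‖z u‖ ≤ Kz) (u : Sp d) (j : Fin p) : |z u j| ≤ Kz :=
  (PiLp.norm_apply_le (z u) j).trans (hKz u)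

lemma inner_meanStat (hz : Measurable z) (hw : Measurable w) (hKz : ∀ u, ‖z u‖ ≤ Kz)
    (hKw : ∀ u, |w u| ≤ Kw) (hD : volume D ≠ ∞) (β δ : Sp p) :
    inner ℝ δ (meanStat z w β D) = ∫ u in D, w u * inner ℝ δ (z u) * rho z β u := by
  have hi : ∀ j, IntegrableOn (fun u => w u * z u j * rho z β u) D := fun j => by
    have := measurable_rho hz β
    refine integrableOn_of_abs_le (by fun_prop) hD
      (C := Kw * Kz * Real.exp (‖β‖ * Kz)) fun u => ?_
    rw [abs_mul, abs_mul, abs_of_pos (rho_pos β u)]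
    have h1 := hKw u
    have h2 := abs_apply_le hKz u j
    have h3 := rho_le hKz β u
    have h4 := (abs_nonneg _).trans h1
    have h5 := (abs_nonneg _).trans h2
    have h6 := (rho_pos (z := z) β u).le
    gcongr
  simp only [meanStat, PiLp.inner_apply, RCLike.inner_apply, conj_trivial]
  simp_rw [← integral_mul_const, Finset.mul_sum, Finset.sum_mul]
  rw [integral_finsetSum _ fun j _ => ?_]
  · refine Finset.sum_congr rfl fun j _ => integral_congr_ae (ae_of_all _ fun u => ?_)
    simp only; ring
  · refine ((hi j).mul_const (δ j)).congr (ae_of_all _ fun u => ?_)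
    simp only; ring

lemma dotProduct_matA (hz : Measurable z) (hw : Measurable w) (hKz : ∀ u, ‖z u‖ ≤ Kz)
    (hKw : ∀ u, |w u| ≤ Kw) (hD : volume D ≠ ∞) (β δ : Sp p) :
    dotProduct δ.ofLp ((matA z w β D).mulVec δ.ofLp) =
      ∫ u in D, w u * inner ℝ δ (z u) ^ 2 * rho z β u := by
  have hi : ∀ i j, IntegrableOn (fun u => w u * (z u i * z u j) * rho z β u) D := fun i j => by
    have := measurable_rho hz β
    refine integrableOn_of_abs_le (by fun_prop) hD
      (C := Kw * (Kz * Kz) * Real.exp (‖β‖ * Kz)) fun u => ?_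
    rw [abs_mul, abs_mul, abs_mul, abs_of_pos (rho_pos β u)]
    have h1 := hKw u
    have h2 := abs_apply_le hKz u i
    have h2' := abs_apply_le hKz u j
    have h3 := rho_le hKz β u
    have h4 := (abs_nonneg _).trans h1
    have h5 := (abs_nonneg _).trans h2
    have h6 := (rho_pos (z := z) β u).le
    gcongr
  have hexp : ∀ u, w u * inner ℝ δ (z u) ^ 2 * rho z β u =
      ∑ i, ∑ j, δ i * (w u * (z u i * z u j) * rho z β u * δ j) := fun u => by
    simp only [PiLp.inner_apply, RCLike.inner_apply, conj_trivial]
    rw [pow_two, Finset.sum_mul_sum, Finset.mul_sum, Finset.sum_mul]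
    refine Finset.sum_congr rfl fun i _ => ?_
    rw [Finset.mul_sum, Finset.sum_mul]
    exact Finset.sum_congr rfl fun j _ => by ring
  simp_rw [hexp]
  rw [integral_finsetSum _ fun i _ =>
    integrable_finsetSum _ fun j _ => ((hi i j).mul_const (δ j)).const_mul (δ i)]
  simp only [dotProduct, Matrix.mulVec, matA, Matrix.of_apply]
  refine Finset.sum_congr rfl fun i _ => ?_
  rw [integral_finsetSum _ fun j _ => ((hi i j).mul_const (δ j)).const_mul (δ i), Finset.mul_sum]
  refine Finset.sum_congr rfl fun j _ => ?_
  rw [integral_const_mul, integral_mul_const]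

/-- Second order expansion of the compensator of the log-likelihood. -/
lemma le_setIntegral_mul_rho_add (hz : Measurable z) (hw : Measurable w)
    (hKz : ∀ u, ‖z u‖ ≤ Kz) (hKw : ∀ u, |w u| ≤ Kw) (hD : volume D ≠ ∞) (β δ : Sp p)
    (hδ : ‖δ‖ * Kz ≤ 1) :
    (∫ u in D, w u * rho z β u) + inner ℝ δ (meanStat z w β D) +
      (1 / 2) * dotProduct δ.ofLp ((matA z w β D).mulVec δ.ofLp) -
      Kw * Kz ^ 3 * Real.exp (‖β‖ * Kz) * ‖δ‖ ^ 3 * volume.real D ≤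
      ∫ u in D, w u * rho z (β + δ) u := by
  have hKw0 : 0 ≤ Kw := (abs_nonneg _).trans (hKw 0)
  have hKz0 : 0 ≤ Kz := (norm_nonneg _).trans (hKz 0)
  have hmr := measurable_rho hz
  set G : ℝ := Real.exp (‖β‖ * Kz)
  have hρ : ∀ u, |rho z β u| ≤ G := fun u => by
    rw [abs_of_pos (rho_pos β u)]; exact rho_le hKz β u
  have i0 : IntegrableOn (fun u => w u * rho z β u) D :=
    integrableOn_of_abs_le (hw.mul (hmr β)) hD (C := Kw * G) fun u => by
      rw [abs_mul]
      exact mul_le_mul (hKw u) (hρ u) (abs_nonneg _) hKw0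
  have i0' : IntegrableOn (fun u => w u * rho z (β + δ) u) D :=
    integrableOn_of_abs_le (hw.mul (hmr (β + δ))) hD (C := Kw * Real.exp (‖β + δ‖ * Kz))
      fun u => by
        rw [abs_mul, abs_of_pos (rho_pos _ u)]
        exact mul_le_mul (hKw u) (rho_le hKz _ u) (rho_pos _ u).le hKw0
  have i1 : IntegrableOn (fun u => w u * inner ℝ δ (z u) * rho z β u) D := by
    have := hmr β
    refine integrableOn_of_abs_le (by fun_prop) hD (C := Kw * (‖δ‖ * Kz) * G) fun u => ?_
    rw [abs_mul, abs_mul]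
    exact mul_le_mul (mul_le_mul (hKw u) (abs_inner_le hKz δ u) (abs_nonneg _) hKw0) (hρ u)
      (abs_nonneg _) (by positivity)
  have i2 : IntegrableOn (fun u => w u * inner ℝ δ (z u) ^ 2 * rho z β u) D := by
    have := hmr β
    refine integrableOn_of_abs_le (by fun_prop) hD (C := Kw * (‖δ‖ * Kz) ^ 2 * G) fun u => ?_
    rw [abs_mul, abs_mul, abs_pow]
    exact mul_le_mul (mul_le_mul (hKw u) (pow_le_pow_left₀ (abs_nonneg _)
      (abs_inner_le hKz δ u) 2) (by positivity) hKw0) (hρ u) (abs_nonneg _) (by positivity)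
  rw [inner_meanStat hz hw hKz hKw hD, dotProduct_matA hz hw hKz hKw hD]
  have hb : ∀ u, |w u * rho z (β + δ) u - (w u * rho z β u + w u * inner ℝ δ (z u) * rho z β u +
      (1 / 2) * (w u * inner ℝ δ (z u) ^ 2 * rho z β u))| ≤ Kw * Kz ^ 3 * G * ‖δ‖ ^ 3 := fun u => by
    have e1 : rho z (β + δ) u = rho z β u * Real.exp (inner ℝ δ (z u)) := by
      rw [rho, rho, inner_add_left, Real.exp_add]
    have e2 : w u * rho z (β + δ) u - (w u * rho z β u + w u * inner ℝ δ (z u) * rho z β u +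
        (1 / 2) * (w u * inner ℝ δ (z u) ^ 2 * rho z β u)) = w u * rho z β u *
        (Real.exp (inner ℝ δ (z u)) - (1 + inner ℝ δ (z u) + inner ℝ δ (z u) ^ 2 / 2)) := by
      rw [e1]; ring
    have h1 := abs_inner_le hKz δ u
    rw [e2, abs_mul, abs_mul]
    calc _ ≤ Kw * G * (‖δ‖ * Kz) ^ 3 :=
          mul_le_mul (mul_le_mul (hKw u) (hρ u) (abs_nonneg _) hKw0)
            ((abs_exp_sub_quadratic_le (h1.trans hδ)).trans
              (pow_le_pow_left₀ (abs_nonneg _) h1 3)) (abs_nonneg _) (by positivity)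
      _ = _ := by ring
  have hi : ‖∫ u in D, (w u * rho z (β + δ) u - (w u * rho z β u +
      w u * inner ℝ δ (z u) * rho z β u + (1 / 2) * (w u * inner ℝ δ (z u) ^ 2 * rho z β u)))‖ ≤
      Kw * Kz ^ 3 * G * ‖δ‖ ^ 3 * volume.real D :=
    norm_setIntegral_le_of_norm_le_const hD.lt_top fun u _ => hb u
  have i01 : IntegrableOn (fun u => w u * rho z β u + w u * inner ℝ δ (z u) * rho z β u) D :=
    i0.add i1
  have i012 : IntegrableOn (fun u => w u * rho z β u + w u * inner ℝ δ (z u) * rho z β u +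
      (1 / 2) * (w u * inner ℝ δ (z u) ^ 2 * rho z β u)) D := i01.add (i2.const_mul (1 / 2))
  rw [integral_sub i0' i012, integral_add i01 (i2.const_mul (1 / 2)),
    integral_add i0 i1, integral_const_mul] at hi
  have := (abs_le.1 hi).1
  linarith

lemma continuous_setIntegral_mul_rho (hz : Measurable z) (hw : Measurable w)
    (hKz : ∀ u, ‖z u‖ ≤ Kz) (hKw : ∀ u, |w u| ≤ Kw) (hD : volume D ≠ ∞) :
    Continuous fun β => ∫ u in D, w u * rho z β u := by
  have : IsFiniteMeasure (volume.restrict D) := ⟨by simpa using hD.lt_top⟩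
  have hKw0 : 0 ≤ Kw := (abs_nonneg _).trans (hKw 0)
  have hKz0 : 0 ≤ Kz := (norm_nonneg _).trans (hKz 0)
  refine continuous_iff_continuousAt.2 fun β => ?_
  refine continuousAt_of_dominated (bound := fun _ => Kw * Real.exp ((‖β‖ + 1) * Kz))
    (Eventually.of_forall fun β' => (hw.mul (measurable_rho hz β')).aestronglyMeasurable) ?_
    (integrable_const _) (ae_of_all _ fun u => ?_)
  · have hb : ∀ᶠ β' in 𝓝 β, ‖β'‖ < ‖β‖ + 1 :=
      continuous_norm.continuousAt.eventually_lt continuousAt_const (by simp)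
    filter_upwards [hb] with β' hβ'
    refine ae_of_all _ fun u => ?_
    rw [norm_mul, Real.norm_eq_abs, Real.norm_of_nonneg (rho_pos β' u).le]
    refine mul_le_mul (hKw u) ((rho_le hKz β' u).trans ?_) (rho_pos β' u).le hKw0
    gcongr
  · unfold rho
    fun_prop

end Likelihood

section LinearStatistic

/-- The linear statistic `∑_{u ∈ X ∩ D} w(u) z(u)`, defined so that it is measurable also on the
null event where `X ∩ D` is infinite. -/
def linStat {Ω : Type*} {d p : ℕ} (X : Ω → Set (Sp d)) (z : Sp d → Sp p) (w : Sp d → ℝ)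
    (D : Set (Sp d)) (ω : Ω) : Sp p :=
  WithLp.toLp 2 fun j => (∫⁻ u in D, ENNReal.ofReal (w u * z u j) ∂(pts X ω)).toReal -
    (∫⁻ u in D, ENNReal.ofReal (-(w u * z u j)) ∂(pts X ω)).toReal

/-- The deterministic part of the penalized log-likelihood. -/
def detPart {d p : ℕ} (z : Sp d → Sp p) (w : Sp d → ℝ) (D : Set (Sp d)) (f : Fin p → ℝ → ℝ)
    (β : Sp p) : ℝ :=
  (∫ u in D, w u * rho z β u) + volume.real D * ∑ j, f j |β j|

lemma penLoglik_eq {Ω : Type*} {d p : ℕ} {X : Ω → Set (Sp d)} {z : Sp d → Sp p} {w : Sp d → ℝ}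
    {D : Set (Sp d)} (hD : MeasurableSet D) (pen : ℝ → ℝ → ℝ) (lam : Fin p → ℝ) {ω : Ω}
    (hfin : (X ω ∩ D).Finite) (β : Sp p) :
    penLoglik z w D pen lam (X ω) β =
      inner ℝ β (linStat X z w D ω) - detPart z w D (fun j => pen (lam j)) β := by
  have h1 : inner ℝ β (linStat X z w D ω) = ∑ᶠ u ∈ X ω ∩ D, w u * Real.log (rho z β u) := by
    rw [finsum_mem_eq_finite_toFinset_sum _ hfin]
    simp only [linStat, PiLp.inner_apply, RCLike.inner_apply, conj_trivial,
      toReal_setLIntegral_pts hD hfin, ← Finset.sum_sub_distrib, max_zero_sub_max_neg_zero_eq_self,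
      Finset.sum_mul, rho, Real.log_exp]
    rw [Finset.sum_comm]
    refine Finset.sum_congr rfl fun u _ => ?_
    rw [Finset.mul_sum]
    exact Finset.sum_congr rfl fun j _ => by ring
  rw [penLoglik, loglik, detPart, h1]
  ring

lemma lowerSemicontinuous_detPart {d p : ℕ} {z : Sp d → Sp p} {w : Sp d → ℝ} {D : Set (Sp d)}
    {Kz Kw : ℝ} (hz : Measurable z) (hw : Measurable w) (hKz : ∀ u, ‖z u‖ ≤ Kz)
    (hKw : ∀ u, |w u| ≤ Kw) (hD : volume D ≠ ∞) {f : Fin p → ℝ → ℝ} (hf : ∀ j, IsPenalty (f j)) :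
    LowerSemicontinuous (detPart z w D f) := by
  have h1 : LowerSemicontinuous fun β : Sp p => ∑ j, f j |β j| :=
    lowerSemicontinuous_sum fun j _ =>
      (hf j).lowerSemicontinuous_comp_abs.comp (by fun_prop : Continuous fun β : Sp p => β j)
  have h2 : LowerSemicontinuous fun β : Sp p => volume.real D * ∑ j, f j |β j| :=
    (continuous_const_mul (volume.real D)).comp_lowerSemicontinuous h1
      (monotone_mul_left_of_nonneg measureReal_nonneg)
  exact (continuous_setIntegral_mul_rho hz hw hKz hKw hD).lowerSemicontinuous.add h2

variable {Ω : Type*} [MeasurableSpace Ω] {d p : ℕ} {P : Measure Ω} {X : Ω → Set (Sp d)}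
  {z : Sp d → Sp p} {w : Sp d → ℝ}

lemma measurable_linStat (hX : IsPointProcess P X) (hz : Measurable z) (hw : Measurable w)
    {D : Set (Sp d)} (hD : MeasurableSet D) : Measurable (linStat X z w D) := by
  have h : ∀ f : Sp d → ℝ≥0∞, Measurable f →
      Measurable fun ω => (∫⁻ u in D, f u ∂(pts X ω)).toReal := fun f hf =>
    ((measurable_setLIntegral_pts X hD hf).mono (sigmaOf_le hX hD) le_rfl).ennreal_toReal
  refine (WithLp.measurable_toLp 2 _).comp (measurable_pi_lambda _ fun j => ?_)
  exact (h _ (by fun_prop)).sub (h _ (by fun_prop))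

lemma meanStat_apply (hX : IsPointProcess P X) {β : Sp p} (hint : HasIntensity P X (rho z β))
    (hz : Measurable z) (hw : Measurable w) {Kz Kw : ℝ} (hKz : ∀ u, ‖z u‖ ≤ Kz)
    (hKw : ∀ u, |w u| ≤ Kw) {D : Set (Sp d)} (hD : MeasurableSet D) (hDfin : volume D ≠ ∞)
    (j : Fin p) :
    meanStat z w β D j =
      (∫⁻ ω, ∫⁻ u in D, ENNReal.ofReal (w u * z u j) ∂(pts X ω) ∂P).toReal -
      (∫⁻ ω, ∫⁻ u in D, ENNReal.ofReal (-(w u * z u j)) ∂(pts X ω) ∂P).toReal := by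
  have hm := measurable_rho hz β
  rw [lintegral_lintegral_pts hX hint (by fun_prop) hD,
    lintegral_lintegral_pts hX hint (by fun_prop) hD]
  have hi : IntegrableOn (fun u => w u * z u j * rho z β u) D := by
    refine integrableOn_of_abs_le (by fun_prop) hDfin
      (C := Kw * Kz * Real.exp (‖β‖ * Kz)) fun u => ?_
    rw [abs_mul, abs_mul, abs_of_pos (rho_pos β u)]
    have h1 := hKw u
    have h2 := abs_apply_le hKz u j
    have h3 := rho_le hKz β u
    have h4 := (abs_nonneg _).trans h1
    have h5 := (abs_nonneg _).trans h2
    have h6 := (rho_pos (z := z) β u).le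
    gcongr
  change ∫ u in D, w u * z u j * rho z β u = _
  rw [integral_eq_lintegral_pos_part_sub_lintegral_neg_part hi]
  simp_rw [← neg_mul, ENNReal.ofReal_mul' (rho_pos β _).le]

lemma norm_le_sum_abs (x : Sp p) : ‖x‖ ≤ ∑ j, |x j| := by
  rw [EuclideanSpace.norm_eq]
  refine Real.sqrt_le_iff.2 ⟨by positivity, ?_⟩
  exact Finset.sum_sq_le_sq_sum_of_nonneg fun j _ => abs_nonneg _

/-- Chebyshev's inequality for the centred linear statistic. -/
lemma exists_meas_lt_norm_linStat_sub_le [IsProbabilityMeasure P] (hX : IsPointProcess P X)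
    {t : ℕ} (ht : 1 ≤ t) {r : (Fin (2 + t) → Sp d) → ℝ}
    (hr : IsProductDensity P X (2 + t) r) {K : ℝ} (hK : ∀ x, r x ≤ K)
    (hmix : ∃ t' : ℝ, (d : ℝ) * (2 + t) / t < t' ∧
      (fun q : ℝ => mixCoef P X 2 ⊤ q) =O[atTop] fun q : ℝ => q ^ (-t'))
    {β : Sp p} (hint : HasIntensity P X (rho z β))
    (hz : Measurable z) (hw : Measurable w) {Kz Kw : ℝ} (hKz : ∀ u, ‖z u‖ ≤ Kz)
    (hKw : ∀ u, |w u| ≤ Kw) :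
    ∃ C : ℝ, 0 ≤ C ∧ ∀ m : ℕ, 1 ≤ m → ∀ D : Set (Sp d), MeasurableSet D → volume D ≠ ∞ →
      (∀ u ∈ D, ‖u‖ ≤ m) → ∀ c : ℝ, 0 < c →
        P {ω | c < ‖linStat X z w D ω - meanStat z w β D‖} ≤
          ENNReal.ofReal (C * (m : ℝ) ^ d / c ^ 2) := by
  rcases Nat.eq_zero_or_pos p with hp | hp
  · subst hp
    refine ⟨0, le_rfl, fun m _ D _ _ _ c hc => ?_⟩
    have : {ω | c < ‖linStat X z w D ω - meanStat z w β D‖} = ∅ := by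
      ext ω
      simp [Subsingleton.elim (linStat X z w D ω - meanStat z w β D) 0, hc.le]
    simp [this]
  obtain ⟨C, hC, hCb⟩ := exists_meas_abs_sub_le hX ht hr hK hmix
    (κ := ENNReal.ofReal (Kw * Kz)) ENNReal.ofReal_ne_top
  have hp0 : (0 : ℝ) < p := by exact_mod_cast hp
  refine ⟨8 * p ^ 3 * C, by positivity, fun m hm D hD hDfin hDm c hc => ?_⟩
  set F : Fin p → Bool → Sp d → ℝ≥0∞ := fun j b u =>
    ENNReal.ofReal (if b then w u * z u j else -(w u * z u j)) with hF
  set T : Fin p → Bool → Ω → ℝ := fun j b ω => (∫⁻ u in D, F j b u ∂(pts X ω)).toReal -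
    (∫⁻ ω, ∫⁻ u in D, F j b u ∂(pts X ω) ∂P).toReal with hT
  have hFm : ∀ j b, Measurable (F j b) := fun j b => by
    cases b <;> simp only [hF, Bool.false_eq_true, if_false, if_true] <;> fun_prop
  have hFb : ∀ j b u, F j b u ≤ ENNReal.ofReal (Kw * Kz) := fun j b u => by
    refine ENNReal.ofReal_le_ofReal ?_
    have h : |w u * z u j| ≤ Kw * Kz := by
      rw [abs_mul]
      exact mul_le_mul (hKw u) (abs_apply_le hKz u j) (abs_nonneg _) ((abs_nonneg _).trans (hKw u))
    rw [abs_le] at h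
    cases b <;> simp only [Bool.false_eq_true, if_false, if_true] <;> linarith
  set c' : ℝ := c / (2 * p) with hc'
  have hc'0 : 0 < c' := by positivity
  have hsub : {ω | c < ‖linStat X z w D ω - meanStat z w β D‖} ⊆
      ⋃ jb : Fin p × Bool, {ω | c' ≤ |T jb.1 jb.2 ω|} := by
    intro ω hω
    by_contra hcon
    simp only [mem_iUnion, mem_ofPred_eq, not_exists, not_le] at hcon
    have hle : ∀ j, |(linStat X z w D ω - meanStat z w β D) j| ≤ 2 * c' := fun j => by
      have e : (linStat X z w D ω - meanStat z w β D) j = T j true ω - T j false ω := by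
        rw [PiLp.sub_apply, meanStat_apply hX hint hz hw hKz hKw hD hDfin]
        simp only [linStat, hT, hF, Bool.false_eq_true, if_false, if_true]
        ring
      rw [e]
      have h1 := hcon (j, true)
      have h2 := hcon (j, false)
      have h3 := abs_sub (T j true ω) (T j false ω)
      simp only at h1 h2
      linarith
    have := (norm_le_sum_abs (linStat X z w D ω - meanStat z w β D)).trans
      (Finset.sum_le_sum fun j _ => hle j)
    rw [Finset.sum_const, Finset.card_univ, Fintype.card_fin, nsmul_eq_mul, hc'] at this
    have e : (p : ℝ) * (2 * (c / (2 * p))) = c := by field_simp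
    rw [e] at this
    exact absurd hω (not_lt.2 this)
  calc _ ≤ P (⋃ jb : Fin p × Bool, {ω | c' ≤ |T jb.1 jb.2 ω|}) := measure_mono hsub
    _ ≤ ∑ jb : Fin p × Bool, P {ω | c' ≤ |T jb.1 jb.2 ω|} := measure_iUnion_fintype_le _ _
    _ ≤ ∑ _jb : Fin p × Bool, ENNReal.ofReal (C * (m : ℝ) ^ d / c' ^ 2) :=
        Finset.sum_le_sum fun jb _ =>
          hCb _ (hFm jb.1 jb.2) (hFb jb.1 jb.2) m hm D hD hDm c' hc'0
    _ = ENNReal.ofReal (8 * p ^ 3 * C * (m : ℝ) ^ d / c ^ 2) := by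
        rw [Finset.sum_const, Finset.card_univ, Fintype.card_prod, Fintype.card_fin,
          Fintype.card_bool, ← ENNReal.ofReal_nsmul, nsmul_eq_mul, hc']
        congr 1
        push_cast
        field_simp
        ring

end LinearStatistic

section Maximizer

variable {d p : ℕ} {z : Sp d → Sp p} {w : Sp d → ℝ} {D : Set (Sp d)} {Kz Kw : ℝ}

/-- A parameter close to `β₀` with at least the same objective value is within the statistical
error of `β₀`. -/
lemma norm_le_of_objective_le (hz : Measurable z) (hw : Measurable w)
    (hKz : ∀ u, ‖z u‖ ≤ Kz) (hKw : ∀ u, |w u| ≤ Kw) (hD : volume D ≠ ∞)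
    (hD0 : 0 < volume.real D) {f : Fin p → ℝ → ℝ} (hf : ∀ j, IsPenalty (f j)) {β₀ : Sp p}
    {s : ℕ} (hs : ∀ j : Fin p, β₀ j ≠ 0 ↔ (j : ℕ) < s) {r : Fin p → ℝ} {M a c κ : ℝ}
    (hM0 : 0 ≤ M) (ha0 : 0 ≤ a) (hc0 : 0 ≤ c) (hκ : 0 < κ)
    (hsm : ∀ j : Fin p, (j : ℕ) < s →
      ContDiffOn ℝ 3 (f j) (Metric.ball |β₀ j| (r j) ∩ Ioi 0) ∧
      ∀ θ ∈ Metric.ball |β₀ j| (r j) ∩ Ioi 0, |iteratedDeriv 3 (f j) θ| ≤ M)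
    (ha : ∀ j : Fin p, (j : ℕ) < s → |deriv (f j) (|β₀ j|)| ≤ a)
    (hc : ∀ j : Fin p, (j : ℕ) < s → |iteratedDeriv 2 (f j) (|β₀ j|)| ≤ c)
    (hA : ∀ x : Sp p, volume.real D * (κ * ‖x‖ ^ 2) ≤
      dotProduct x.ofLp ((matA z w β₀ D).mulVec x.ofLp)) {δ S : Sp p}
    (hr : ∀ j : Fin p, (j : ℕ) < s → ‖δ‖ < r j)
    (hδ : ∀ j : Fin p, (j : ℕ) < s → ‖δ‖ < |β₀ j|) (hδz : ‖δ‖ * Kz ≤ 1)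
    (hδκ : Kw * Kz ^ 3 * Real.exp (‖β₀‖ * Kz) * ‖δ‖ + p * (c + M * ‖δ‖) ≤ κ / 4)
    (hobj : inner ℝ β₀ S - detPart z w D f β₀ ≤ inner ℝ (β₀ + δ) S - detPart z w D f (β₀ + δ)) :
    ‖δ‖ ≤ 4 / κ * (‖S - meanStat z w β₀ D‖ / volume.real D + p * a) := by
  set v : ℝ := volume.real D
  set G : ℝ := Kw * Kz ^ 3 * Real.exp (‖β₀‖ * Kz)
  set U : Sp p := S - meanStat z w β₀ D with hU
  have h1 := le_setIntegral_mul_rho_add hz hw hKz hKw hD β₀ δ hδz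
  have h2 := le_sum_penalty_sub hf hs hM0 ha0 hc0 hsm ha hc hr hδ
  rw [Finset.sum_sub_distrib] at h2
  have h3 := hA δ
  have h4 : inner ℝ δ U ≤ ‖δ‖ * ‖U‖ := real_inner_le_norm δ U
  rw [hU, inner_sub_right, ← hU] at h4
  rw [inner_add_left, detPart, detPart] at hobj
  have h5 := mul_le_mul_of_nonneg_left h2 hD0.le
  have h6 := mul_le_mul_of_nonneg_left hδκ (by positivity : 0 ≤ v * ‖δ‖ ^ 2)
  have h7 : v * (κ / 4) * ‖δ‖ ^ 2 ≤ ‖δ‖ * (‖U‖ + v * (p * a)) := by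
    simp only [v] at h1 h3 h5 h6 hobj ⊢
    linarith
  rcases (norm_nonneg δ).eq_or_lt with h0 | h0
  · rw [← h0]; positivity
  · have h8 : v * (κ / 4) * ‖δ‖ ≤ ‖U‖ + v * (p * a) := by
      refine le_of_mul_le_mul_left ?_ h0
      linarith
    calc ‖δ‖ = 4 / κ * (v * (κ / 4) * ‖δ‖ / v) := by field_simp
      _ ≤ 4 / κ * ((‖U‖ + v * (p * a)) / v) := by gcongr
      _ = _ := by field_simp

end Maximizer

section Asymptotics

lemma exists_tendsto_atTop_le {ι : Type*} (s : Finset ι) (f₀ : ℕ → ℝ) (hf₀ : Tendsto f₀ atTop atTop)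
    (f : ι → ℕ → ℝ) (hf : ∀ i ∈ s, Tendsto (f i) atTop atTop) :
    ∃ g : ℕ → ℝ, Tendsto g atTop atTop ∧ (∀ n, g n ≤ f₀ n) ∧ ∀ i ∈ s, ∀ n, g n ≤ f i n := by
  classical
  induction s using Finset.induction_on with
  | empty => exact ⟨f₀, hf₀, fun n => le_rfl, by simp⟩
  | insert a s ha ih =>
    obtain ⟨g, hg, hg₀, hgs⟩ := ih fun i hi => hf i (Finset.mem_insert_of_mem hi)
    refine ⟨fun n => min (g n) (f a n), ?_, fun n => (min_le_left _ _).trans (hg₀ n), ?_⟩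
    · exact tendsto_inf_atTop _ hg (hf a (Finset.mem_insert_self a s))
    · intro i hi n
      rcases Finset.mem_insert.1 hi with rfl | hi
      · exact min_le_right _ _
      · exact (min_le_left _ _).trans (hgs i hi n)

lemma IsBigOP.of_le {Ω : Type*} [MeasurableSpace Ω] {P : Measure Ω} {Y : ℕ → Ω → ℝ}
    {r r' : ℕ → ℝ} (h : IsBigOP P Y r) {A : ℝ} (hr : ∀ᶠ n in atTop, 0 ≤ r n)
    (hle : ∀ᶠ n in atTop, r n ≤ A * r' n) : IsBigOP P Y r' := by
  intro ε hε
  obtain ⟨M, hM⟩ := h ε hε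
  refine ⟨max M 0 * A, ?_⟩
  filter_upwards [hM, hr, hle] with n h1 h2 h3
  refine (measure_mono fun ω hω => ?_).trans h1
  have h4 : M * r n ≤ max M 0 * A * r' n := by
    calc M * r n ≤ max M 0 * r n := by gcongr; exact le_max_left _ _
      _ ≤ max M 0 * (A * r' n) := by gcongr
      _ = _ := by ring
  exact h4.trans_lt hω

variable {d : ℕ}

lemma vol_eq_mul (E : Set (Sp d)) (n : ℕ) :
    vol E n = (n : ℝ) ^ d * (volume : Measure (Sp d)).real E := by
  rw [vol, dom, measureReal_def, Measure.addHaar_smul]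
  simp [measureReal_def]

lemma volume_real_pos {E : Set (Sp d)} (hE : IsCompact E) (hE0 : (0 : Sp d) ∈ interior E) :
    0 < (volume : Measure (Sp d)).real E :=
  ENNReal.toReal_pos (Measure.measure_pos_of_nonempty_interior _ ⟨0, hE0⟩).ne' hE.measure_lt_top.ne

lemma tendsto_vol (hd : 1 ≤ d) {E : Set (Sp d)} (hE : IsCompact E)
    (hE0 : (0 : Sp d) ∈ interior E) : Tendsto (vol E) atTop atTop := by
  have h : vol E = fun n : ℕ => (n : ℝ) ^ d * (volume : Measure (Sp d)).real E :=
    funext fun n => vol_eq_mul E n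
  rw [h]
  exact ((tendsto_pow_atTop (by omega)).comp tendsto_natCast_atTop_atTop).atTop_mul_const
    (volume_real_pos hE hE0)

lemma isCompact_dom {E : Set (Sp d)} (hE : IsCompact E) (n : ℕ) : IsCompact (dom E n) :=
  hE.smul (n : ℝ)

lemma isLocalMax_of_isMaxOn_closedBall {V : Type*} [SeminormedAddCommGroup V] {F : V → ℝ}
    {β₀ β : V} {r : ℝ} (hβ : ‖β - β₀‖ < r) (h : ∀ γ ∈ Metric.closedBall β₀ r, F γ ≤ F β) :
    IsLocalMax F β := by
  have hmem : Metric.closedBall β₀ r ∈ 𝓝 β :=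
    mem_of_superset (Metric.isOpen_ball.mem_nhds (by rwa [Metric.mem_ball, dist_eq_norm]))
      Metric.ball_subset_closedBall
  filter_upwards [hmem] with γ hγ using h γ hγ

end Asymptotics

end PenPP

end

theorem theorem1
    {Ω : Type*} [MeasurableSpace Ω] (P : Measure Ω) [IsProbabilityMeasure P]
    {d p : ℕ} (hd : 1 ≤ d)
    -- the point process
    (X : Ω → Set (PenPP.Sp d)) (hX : PenPP.IsPointProcess P X)
    -- (C.1) the observation domains `D_n = nE`
    (E : Set (PenPP.Sp d)) (hEconv : Convex ℝ E) (hEcomp : IsCompact E)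
    (hE0 : (0 : PenPP.Sp d) ∈ interior E)
    -- (C.2) log-linear intensity with true parameter `β₀ ∈ Θ`
    (z : PenPP.Sp d → PenPP.Sp p) (hz : Measurable z)
    (Θ : Set (PenPP.Sp p)) (hΘo : IsOpen Θ) (hΘc : Convex ℝ Θ) (hΘb : Bornology.IsBounded Θ)
    (β₀ : PenPP.Sp p) (hβ₀ : β₀ ∈ Θ)
    (hint : PenPP.HasIntensity P X (PenPP.rho z β₀))
    -- exactly the first `s` coefficients are nonzero
    (s : ℕ) (hsp : s ≤ p) (hs : ∀ j : Fin p, β₀ j ≠ 0 ↔ (j : ℕ) < s)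
    -- (C.3) bounded covariates and weights
    (w : PenPP.Sp d → ℝ) (hw : Measurable w)
    (hzb : ∃ K, ∀ u, ‖z u‖ ≤ K) (hwb : ∃ K, ∀ u, |w u| ≤ K)
    -- (C.4) bounded product densities of orders `2, …, 2 + t`
    (t : ℕ) (ht : 1 ≤ t) (ρ : (k : ℕ) → (Fin k → PenPP.Sp d) → ℝ)
    (hρ : ∀ k, 2 ≤ k → k ≤ 2 + t →
      PenPP.IsProductDensity P X k (ρ k) ∧ ∃ K, ∀ x, ρ k x ≤ K)
    -- (C.5) strong mixing
    (hmix : ∃ t' : ℝ, (d : ℝ) * (2 + t) / t < t' ∧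
      (fun q : ℝ => PenPP.mixCoef P X 2 ⊤ q) =O[atTop] fun q : ℝ => q ^ (-t'))
    -- (C.6)
    (hBC : ∃ I₀ : Matrix (Fin p) (Fin p) ℝ, I₀.PosDef ∧ ∀ᶠ n : ℕ in atTop,
      ((PenPP.vol E n)⁻¹ • (PenPP.matB z w β₀ (PenPP.dom E n) +
        PenPP.matC z w β₀ (ρ 2) (PenPP.dom E n)) - I₀).PosSemidef)
    -- (C.7)
    (hA : ∃ I₀ : Matrix (Fin p) (Fin p) ℝ, I₀.PosDef ∧ ∀ᶠ n : ℕ in atTop,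
      ((PenPP.vol E n)⁻¹ • PenPP.matA z w β₀ (PenPP.dom E n) - I₀).PosSemidef)
    -- (C.8) the penalty functions `p_λ`, `λ ≥ 0`, and the tuning parameters `λ_{n,j}`
    (pen : ℝ → ℝ → ℝ) (hpen : ∀ l, 0 ≤ l → PenPP.IsPenalty (pen l))
    (lam : ℕ → Fin p → ℝ) (hlam : ∀ n j, 0 ≤ lam n j)
    (hsmooth : ∃ (r : ℕ → Fin p → ℝ) (M : ℝ),
      (∀ j : Fin p, (j : ℕ) < s →
        Tendsto (fun n : ℕ => (PenPP.vol E n) ^ (1 / 2 : ℝ) * r n j) atTop atTop) ∧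
      ∀ᶠ n : ℕ in atTop, ∀ j : Fin p, (j : ℕ) < s →
        ContDiffOn ℝ 3 (pen (lam n j)) (Metric.ball |β₀ j| (r n j) ∩ Ioi 0) ∧
        ∀ θ ∈ Metric.ball |β₀ j| (r n j) ∩ Ioi 0, |iteratedDeriv 3 (pen (lam n j)) θ| ≤ M)
    -- the assumptions on `a_n` and `c_n`
    (ha : PenPP.seqA pen lam β₀ s =O[atTop] fun n : ℕ => (PenPP.vol E n) ^ (-(1 / 2) : ℝ))
    (hc : Tendsto (PenPP.seqC pen lam β₀ s) atTop (𝓝 0)) :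
    ∃ βhat : ℕ → Ω → PenPP.Sp p,
      (∀ n, Measurable (βhat n)) ∧
      -- with probability tending to one, `βhat n` is a local maximizer of `Q(w; ·)`
      Tendsto (fun n : ℕ => P {ω | ¬ (βhat n ω ∈ Θ ∧
        IsLocalMax (PenPP.penLoglik z w (PenPP.dom E n) pen (lam n) (X ω)) (βhat n ω))})
        atTop (𝓝 0) ∧
      PenPP.IsBigOP P (fun n ω => ‖βhat n ω - β₀‖)
        (fun n => (PenPP.vol E n) ^ (-(1 / 2) : ℝ) + PenPP.seqA pen lam β₀ s n) ∧
      PenPP.IsBigOP P (fun n ω => ‖βhat n ω - β₀‖)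
        (fun n => (PenPP.vol E n) ^ (-(1 / 2) : ℝ)) := by
  open PenPP in
  obtain ⟨Kz, hKz⟩ := hzb
  obtain ⟨Kw, hKw⟩ := hwb
  obtain ⟨hρt, K, hK⟩ := hρ (2 + t) (by omega) le_rfl
  obtain ⟨r, M₀, hr, hsm₀⟩ := hsmooth
  obtain ⟨I₀, hI₀, hAI⟩ := hA
  obtain ⟨κ, hκ, hκI⟩ := exists_pos_mul_norm_sq_le_of_posDef hI₀
  obtain ⟨C₀, hC₀, htail₀⟩ := exists_meas_lt_norm_linStat_sub_le hX ht hρt hK hmix hint hz hw hKz hKw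
  -- volumes
  have hV := tendsto_vol hd hEcomp hE0
  have hVpos : ∀ᶠ n in atTop, 0 < vol E n := hV.eventually_gt_atTop 0
  have hVE := volume_real_pos hEcomp hE0
  have hDm : ∀ n, MeasurableSet (dom E n) := fun n => (isCompact_dom hEcomp n).measurableSet
  have hDfin : ∀ n, volume (dom E n) ≠ ∞ := fun n => (isCompact_dom hEcomp n).measure_lt_top.ne
  set v : ℕ → ℝ := fun n => vol E n ^ (-(1 / 2) : ℝ) with hv
  set a : ℕ → ℝ := seqA pen lam β₀ s with ha_def
  set c : ℕ → ℝ := seqC pen lam β₀ s with hc_def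
  have ha0 : ∀ n, 0 ≤ a n := fun n => Real.iSup_nonneg fun j => abs_nonneg _
  have hc0 : ∀ n, 0 ≤ c n := fun n => Real.iSup_nonneg fun j => abs_nonneg _
  have hale : ∀ n, ∀ j : Fin p, (j : ℕ) < s → |deriv (pen (lam n j)) (|β₀ j|)| ≤ a n :=
    fun n j hj => le_ciSup (f := fun j : {j : Fin p // (j : ℕ) < s} =>
      |deriv (pen (lam n j)) (|β₀ j|)|) (Set.finite_range _).bddAbove ⟨j, hj⟩
  have hcle : ∀ n, ∀ j : Fin p, (j : ℕ) < s → |iteratedDeriv 2 (pen (lam n j)) (|β₀ j|)| ≤ c n :=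
    fun n j hj => le_ciSup (f := fun j : {j : Fin p // (j : ℕ) < s} =>
      |iteratedDeriv 2 (pen (lam n j)) (|β₀ j|)|) (Set.finite_range _).bddAbove ⟨j, hj⟩
  have hv0 : ∀ n, 0 ≤ v n := fun n => Real.rpow_nonneg measureReal_nonneg _
  have hvpos : ∀ᶠ n in atTop, 0 < v n := hVpos.mono fun n hn => Real.rpow_pos_of_pos hn _
  have hvV : ∀ᶠ n in atTop, vol E n ^ (1 / 2 : ℝ) * v n = 1 := hVpos.mono fun n hn => by
    rw [hv, ← Real.rpow_add hn]; norm_num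
  have hvVdiv : ∀ᶠ n in atTop, vol E n ^ (1 / 2 : ℝ) / vol E n = v n := hVpos.mono fun n hn => by
    rw [hv]
    nth_rw 2 [← Real.rpow_one (vol E n)]
    rw [← Real.rpow_sub hn]; norm_num
  -- the centred linear statistic is of the order of the square root of the volume
  obtain ⟨R₀, hR₀⟩ : ∃ R₀ : ℕ, 1 ≤ R₀ ∧ ∀ u ∈ E, ‖u‖ ≤ R₀ := by
    obtain ⟨C, hC⟩ := hEcomp.isBounded.exists_norm_le
    obtain ⟨N, hN⟩ := exists_nat_ge C
    refine ⟨N + 1, by omega, fun u hu => ?_⟩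
    push_cast
    linarith [hC u hu]
  set C₁ : ℝ := C₀ * (R₀ : ℝ) ^ d / (volume : Measure (Sp d)).real E
  have hC₁ : 0 ≤ C₁ := by positivity
  have htail : ∀ᶠ n in atTop, ∀ T : ℝ, 0 < T →
      P {ω | T * vol E n ^ (1 / 2 : ℝ) <
        ‖linStat X z w (dom E n) ω - meanStat z w β₀ (dom E n)‖} ≤
        ENNReal.ofReal (C₁ / T ^ 2) := by
    filter_upwards [hVpos, eventually_ge_atTop 1] with n hn hn1 T hT
    have hbd : ∀ u ∈ dom E n, ‖u‖ ≤ (n * R₀ : ℕ) := by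
      rintro u ⟨e, he, rfl⟩
      simp only [norm_smul, Real.norm_natCast]
      push_cast
      gcongr
      exact hR₀.2 e he
    refine (htail₀ (n * R₀) (Nat.mul_pos hn1 hR₀.1) (dom E n) (hDm n) (hDfin n) hbd
      (T * vol E n ^ (1 / 2 : ℝ)) (by positivity)).trans (le_of_eq ?_)
    congr 1
    have hsq : (vol E n ^ (1 / 2 : ℝ)) ^ 2 = vol E n := by
      rw [← Real.rpow_natCast, ← Real.rpow_mul hn.le]; norm_num
    rw [mul_pow T, hsq, vol_eq_mul]
    have hn' : (0 : ℝ) < n := by exact_mod_cast hn1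
    push_cast
    rw [mul_pow]
    simp only [C₁]
    field_simp
  -- radii of the balls over which the objective is maximized
  obtain ⟨L, hL, hLV, hLr⟩ := exists_tendsto_atTop_le
    (Finset.univ.filter fun j : Fin p => (j : ℕ) < s) (fun n => vol E n ^ (1 / 2 : ℝ))
    ((tendsto_rpow_atTop (by norm_num)).comp hV) (fun j n => vol E n ^ (1 / 2 : ℝ) * r n j)
    (fun j hj => hr j (Finset.mem_filter.1 hj).2)
  set R : ℕ → ℝ := fun n => √(L n) with hR_def
  have hR : Tendsto R atTop atTop := Real.tendsto_sqrt_atTop.comp hL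
  set rad : ℕ → ℝ := fun n => R n * v n with hrad_def
  have hrad0 : ∀ n, 0 ≤ rad n := fun n => mul_nonneg (Real.sqrt_nonneg _) (hv0 n)
  have hradL : ∀ᶠ n in atTop, R n * rad n = L n * v n :=
    (hL.eventually_ge_atTop 0).mono fun n hn => by
      rw [hrad_def, ← mul_assoc, Real.mul_self_sqrt hn]
  have hrad : Tendsto rad atTop (𝓝 0) := by
    refine squeeze_zero' (Eventually.of_forall hrad0) ?_ hR.inv_tendsto_atTop
    filter_upwards [hradL, hvV, hR.eventually_gt_atTop 0] with n h1 h2 h3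
    have h4 : R n * rad n ≤ 1 := by
      rw [h1, ← h2]
      exact mul_le_mul_of_nonneg_right (hLV n) (hv0 n)
    rw [Pi.inv_apply, ← one_div, le_div_iff₀ h3]
    linarith
  have hradr : ∀ᶠ n in atTop, ∀ j : Fin p, (j : ℕ) < s → rad n < r n j := by
    filter_upwards [hradL, hvV, hR.eventually_gt_atTop 1, hvpos] with n h1 h2 h3 h4 j hj
    have h5 : 0 < rad n := mul_pos (by linarith) h4
    have h6 : L n * v n ≤ r n j := by
      calc L n * v n ≤ vol E n ^ (1 / 2 : ℝ) * r n j * v n :=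
            mul_le_mul_of_nonneg_right (hLr j (by simp [hj]) n) h4.le
        _ = vol E n ^ (1 / 2 : ℝ) * v n * r n j := by ring
        _ = r n j := by rw [h2, one_mul]
    calc rad n < R n * rad n := lt_mul_of_one_lt_left h5 h3
      _ ≤ r n j := h1 ▸ h6
  -- the estimator
  have hIsPen : ∀ n j, IsPenalty (pen (lam n j)) := fun n j => hpen _ (hlam n j)
  have hsel := fun n => exists_measurable_argmax (isCompact_closedBall β₀ (rad n))
    (Metric.nonempty_closedBall.2 (hrad0 n))
    (lowerSemicontinuous_detPart hz hw hKz hKw (hDfin n) (hIsPen n))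
  choose g hgm hg using hsel
  set βhat : ℕ → Ω → Sp p := fun n ω => g n (linStat X z w (dom E n) ω) with hβhat
  have hmem : ∀ n ω, ‖βhat n ω - β₀‖ ≤ rad n := fun n ω => by
    have := (hg n (linStat X z w (dom E n) ω)).1
    rwa [Metric.mem_closedBall, dist_eq_norm] at this
  set M : ℝ := max M₀ 0
  have hbound : ∀ᶠ n in atTop, ∀ ω, ‖βhat n ω - β₀‖ ≤
      4 / κ * (‖linStat X z w (dom E n) ω - meanStat z w β₀ (dom E n)‖ / vol E n + p * a n) := by
    have e1 : ∀ᶠ n in atTop, ∀ j : Fin p, (j : ℕ) < s → rad n < |β₀ j| :=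
      eventually_all.2 fun j => by
        by_cases hj : (j : ℕ) < s
        · exact (hrad.eventually_lt_const (abs_pos.2 ((hs j).2 hj))).mono fun n hn _ => hn
        · exact Eventually.of_forall fun n h => absurd h hj
    have e2 : ∀ᶠ n in atTop, rad n * Kz < 1 := by
      have : Tendsto (fun n => rad n * Kz) atTop (𝓝 0) := by simpa using hrad.mul_const Kz
      exact this.eventually_lt_const one_pos
    have e3 : ∀ᶠ n in atTop, Kw * Kz ^ 3 * Real.exp (‖β₀‖ * Kz) * rad n +
        p * (c n + M * rad n) < κ / 4 := by
      have : Tendsto (fun n => Kw * Kz ^ 3 * Real.exp (‖β₀‖ * Kz) * rad n +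
          p * (c n + M * rad n)) atTop (𝓝 0) := by
        simpa using (hrad.const_mul (Kw * Kz ^ 3 * Real.exp (‖β₀‖ * Kz))).add
          ((hc.add (hrad.const_mul M)).const_mul (p : ℝ))
      exact this.eventually_lt_const (by positivity)
    filter_upwards [e1, e2, e3, hradr, hsm₀, hAI, hVpos] with n h1 h2 h3 h4 h5 h6 h7 ω
    have hKz0 : 0 ≤ Kz := (norm_nonneg _).trans (hKz 0)
    have hKw0 : 0 ≤ Kw := (abs_nonneg _).trans (hKw 0)
    have hδ := hmem n ω
    refine norm_le_of_objective_le hz hw hKz hKw (hDfin n) h7 (hIsPen n) hs (r := r n) (M := M)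
      (le_max_right _ _) (ha0 n) (hc0 n) hκ
      (fun j hj => ⟨(h5 j hj).1, fun θ hθ => ((h5 j hj).2 θ hθ).trans (le_max_left _ _)⟩)
      (hale n) (hcle n) (mul_norm_sq_le_of_posSemidef h7 hκI h6)
      (fun j hj => hδ.trans_lt (h4 j hj)) (fun j hj => hδ.trans_lt (h1 j hj))
      ((mul_le_mul_of_nonneg_right hδ hKz0).trans h2.le) (le_trans ?_ h3.le) ?_
    · have : 0 ≤ M := le_max_right _ _
      gcongr
    · rw [add_sub_cancel]
      exact (hg n (linStat X z w (dom E n) ω)).2 β₀ (Metric.mem_closedBall_self (hrad0 n))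
  have hOP : IsBigOP P (fun n ω => ‖βhat n ω - β₀‖) (fun n => v n + a n) := by
    intro ε hε
    obtain ⟨T, hT, hTε⟩ : ∃ T : ℝ, 0 < T ∧ C₁ / T ^ 2 ≤ ε := by
      have h : Tendsto (fun T : ℝ => C₁ / T ^ 2) atTop (𝓝 0) :=
        tendsto_const_nhds.div_atTop (tendsto_pow_atTop two_ne_zero)
      obtain ⟨T, h1, h2⟩ := ((h.eventually_lt_const hε).and (eventually_gt_atTop 0)).exists
      exact ⟨T, h2, h1.le⟩
    refine ⟨4 / κ * (T + p), ?_⟩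
    filter_upwards [hbound, htail, hvVdiv, hVpos] with n h1 h2 h3 h4
    refine (measure_mono fun ω hω => ?_).trans ((h2 T hT).trans (ENNReal.ofReal_le_ofReal hTε))
    by_contra hcon
    have hcon' : ‖linStat X z w (dom E n) ω - meanStat z w β₀ (dom E n)‖ ≤
        T * vol E n ^ (1 / 2 : ℝ) := not_lt.1 hcon
    have hω' : 4 / κ * (T + p) * (v n + a n) < |‖βhat n ω - β₀‖| := hω
    refine absurd hω' (not_lt.2 ?_)
    rw [abs_of_nonneg (norm_nonneg _)]
    have h5 : ‖linStat X z w (dom E n) ω - meanStat z w β₀ (dom E n)‖ / vol E n ≤ T * v n := by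
      rw [← h3, ← mul_div_assoc]
      gcongr
    calc ‖βhat n ω - β₀‖ ≤ 4 / κ * (T * v n + p * a n) := (h1 ω).trans (by gcongr)
      _ ≤ 4 / κ * ((T + p) * (v n + a n)) := by
        have h6 : 0 ≤ T * a n + p * v n :=
          add_nonneg (mul_nonneg hT.le (ha0 n)) (mul_nonneg (by positivity) (hv0 n))
        gcongr
        linarith
      _ = _ := by ring
  have hOP' : IsBigOP P (fun n ω => ‖βhat n ω - β₀‖) v := by
    obtain ⟨A, hA⟩ := ha.bound
    refine hOP.of_le (A := 1 + A) (Eventually.of_forall fun n => add_nonneg (hv0 n) (ha0 n)) ?_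
    filter_upwards [hA] with n hn
    rw [Real.norm_of_nonneg (ha0 n), Real.norm_of_nonneg (hv0 n)] at hn
    linarith
  refine ⟨βhat, fun n => (hgm n).comp (measurable_linStat hX hz hw (hDm n)), ?_, hOP, hOP'⟩
  obtain ⟨η, hη, hηΘ⟩ := Metric.isOpen_iff.1 hΘo β₀ hβ₀
  rw [ENNReal.tendsto_nhds_zero]
  intro ε hε
  obtain ⟨ε', hε', hε'ε⟩ := ENNReal.lt_iff_exists_nnreal_btwn.1 hε
  obtain ⟨T, hT⟩ := hOP' ε' (by exact_mod_cast hε')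
  rw [ENNReal.ofReal_coe_nnreal] at hT
  filter_upwards [hT, hR.eventually_gt_atTop T, hvpos, hrad.eventually_lt_const hη]
    with n h1 h2 h3 h4
  refine (measure_mono_ae ?_).trans (h1.trans hε'ε.le)
  filter_upwards [hX.locally_finite (dom E n) (isCompact_dom hEcomp n).isBounded] with ω hω hbad
  by_contra hcon
  have hcon' : ‖βhat n ω - β₀‖ ≤ T * v n := by
    have := not_lt.1 hcon
    rwa [abs_of_nonneg (norm_nonneg _)] at this
  have hlt : ‖βhat n ω - β₀‖ < rad n := hcon'.trans_lt (mul_lt_mul_of_pos_right h2 h3)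
  refine hbad ⟨hηΘ ?_, isLocalMax_of_isMaxOn_closedBall hlt fun γ hγ => ?_⟩
  · rw [Metric.mem_ball, dist_eq_norm]
    exact hlt.trans h4
  · rw [penLoglik_eq (hDm n) pen (lam n) hω, penLoglik_eq (hDm n) pen (lam n) hω]
    exact (hg n (linStat X z w (dom E n) ω)).2 γ hγ
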